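/- Let $\Omega_i\subset\mathbb R^3$ be a bounded open set with $C^\infty$ boundary $\Gamma$, let $n$ be the unit normal on $\Gamma$ directed to the interior of $\Omega_i$, and let $\omega>0$, $\varepsilon_r>0$. Let $\nabla_\Gamma$ be the surface gradient on $\Gamma$ and, for a vector field $V$ and a matrix field $A$ on $\Gamma$, put $(A\nabla_\Gamma)\cdot V=\sum_{i=1}^3 (A\nabla_\Gamma V_i)_i$, $\operatorname{div}_\Gamma V=\sum_{i=1}^3(\nabla_\Gamma V_i)_i$, $\operatorname{curl}_\Gamma V=\operatorname{div}_\Gamma(V\times n)$, and $\overrightarrow{\operatorname{curl}}_\Gamma\varphi=(\nabla_\Gamma\varphi)\times n$ for a scalar field $\varphi$. Let $\mathcal C=\nabla_\Gamma n$ be the curvature tensor (with $\mathcal C n=0$), $c_1,c_2$ its other two eigenvalues, $h=\frac12(c_1+c_2)$, $g=c_1c_2$, $I_\Gamma$ the projection on the tangent plane, $\mathcal G=g I_\Gamma$, $\mathcal M=2hI_\Gamma-\mathcal C$, and $$C_\Gamma V=(\operatorname{curl}_\Gamma V)\,n+\overrightarrow{\operatorname{curl}}_\Gamma(V\cdot n)-(\mathcal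 CV)\times n,$$ $$C_\Gamma^M V=\big[(\mathcal M\nabla_\Gamma)\cdot(V\times n)\big]n+\big(\mathcal M\nabla_\Gamma(V\cdot n)\big)\times n-(\mathcal GV)\times n .$$ For profiles $u,v:\Gamma\times[0,\infty)\to\mathbb C^3$, functions of $(x_\Gamma,\eta)$, set $$A_H^{(1)}(u,v)=C_\Gamma v-2h\eta\big(\partial_\eta v\times n+\tfrac1\omega u\big),$$ $$A_H^{(2)}(u,v)=-i\varepsilon_r\omega\,u+\eta\,C_\Gamma^M v-g\eta^2\big(\partial_\eta v\times n+\tfrac1\omega u\big),$$ $$A_H^{(3)}(u,v)=-2\eta h\,i\varepsilon_r\omega\,u,\qquad A_H^{(4)}(u,v)=-\eta^2 g\,i\varepsilon_r\omega\,u,$$ $$A_E^{(1)}(u,v)=-C_\Gamma u+2h\eta\big(\partial_\eta u\times n-i\omega v\big),$$ $$A_E^{(2)}(u,v)=-\eta\,C_\Gamma^M u+g\eta^2\big(\partial_\eta u\times n-i\omega v\big).$$ Let the fields $H_e^k$, $k=0,1,2,\dots$, with values in $\mathbb C^3$, be given on $\Gamma$ with $H_e^k\times n\in C^\infty(\Gamma;\mathbb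 C^3)$. Then there is a unique sequence $(\widehat{\mathbb E}_i^k,H_i^k)_{k\ge0}$ of pairs of $C^\infty$ functions $\Gamma\times[0,\infty)\to\mathbb C^3$ such that, for all $k\ge 0$ and with the convention $\widehat{\mathbb E}_i^{\ell}=H_i^{\ell}=0$ for $\ell<0$, $$\partial_\eta H_i^k\times n+\tfrac1\omega\widehat{\mathbb E}_i^k=\sum_{\ell=1}^4A_H^{(\ell)}(\widehat{\mathbb E}_i^{k-\ell},H_i^{k-\ell}),\qquad -\partial_\eta\widehat{\mathbb E}_i^k\times n+i\omega H_i^k=\sum_{\ell=1}^2A_E^{(\ell)}(\widehat{\mathbb E}_i^{k-\ell},H_i^{k-\ell})$$ on $\Gamma\times[0,\infty)$ and, for every $x_\Gamma\in\Gamma$, $$H_i^k(x_\Gamma,0)\times n=(H_e^k\times n)(x_\Gamma),\qquad \int_0^\infty|H_i^k(x_\Gamma,\eta)|^2d\eta<\infty,\qquad \int_0^\infty|\widehat{\mathbb E}_i^k(x_\Gamma,\eta)|^2d\eta<\infty .$$ Moreover, with $\sqrt i=\frac{\sqrt2}{2}(1+i)$, for every $k$ each of $e^{\sqrt i\,\eta}\,\widehat{\mathbb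 E}_i^k$ and $e^{\sqrt i\,\eta}\,H_i^k$ is of the form $\sum_{j=0}^k a_j(x_\Gamma)\,\eta^j$ with $a_j\in C^\infty(\Gamma;\mathbb C^3)$. -/

import Mathlib

open scoped ContDiff Matrix

noncomputable section

namespace BoundaryLayer

/-- Points of `ℝ³`. -/
abbrev E3 : Type := EuclideanSpace ℝ (Fin 3)

/-- Values of complex vector fields. -/
abbrev C3 : Type := Fin 3 → ℂ

/-- A boundary-layer profile `(x, η) ↦ u x η`; only its values for `x ∈ Γ` and `η ≥ 0` matter. -/
abbrev Profile : Type := E3 → ℝ → C3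

/-! ### The domain, its boundary and the normal -/

/-- `ρ` is a smooth defining function of `Ω` in the neighbourhood `U` of the boundary point `x`. -/
structure IsLocalDefiningFunction (Ω : Set E3) (x : E3) (U : Set E3) (ρ : E3 → ℝ) : Prop where
  isOpen : IsOpen U
  mem : x ∈ U
  contDiffOn : ContDiffOn ℝ ∞ ρ U
  gradient_ne_zero : ∀ y ∈ U, gradient ρ y ≠ 0
  mem_iff : ∀ y ∈ U, (y ∈ Ω ↔ ρ y < 0)
  mem_frontier_iff : ∀ y ∈ U, (y ∈ frontier Ω ↔ ρ y = 0)

/-- A bounded open set of `ℝ³` with `C^∞` boundary. -/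
structure IsSmoothBoundedDomain (Ω : Set E3) : Prop where
  isOpen : IsOpen Ω
  isBounded : Bornology.IsBounded Ω
  smooth : ∀ x ∈ frontier Ω, ∃ U ρ, IsLocalDefiningFunction Ω x U ρ

/-- `v = -∇ρ(x) / |∇ρ(x)|` for a local defining function `ρ` at the boundary point `x`: the unit
normal at `x` directed to the interior of `Ω` (the same for all choices of `ρ`). -/
def IsInwardUnitNormal (Ω : Set E3) (x v : E3) : Prop :=
  ∃ U ρ, IsLocalDefiningFunction Ω x U ρ ∧ v = -((‖gradient ρ x‖)⁻¹ • gradient ρ x)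

open Classical in
/-- The inward unit normal field `n` on `Γ = ∂Ω` (with the irrelevant value `0` elsewhere). -/
def normal (Ω : Set E3) (x : E3) : E3 :=
  if h : x ∈ frontier Ω ∧ ∃ v, IsInwardUnitNormal Ω x v then h.2.choose else 0

/-- The normal as a vector of `ℂ³`. -/
def nC (Ω : Set E3) (x : E3) : C3 := fun j => (normal Ω x j : ℂ)

/-! ### Surface differential operators -/

/-- The `j`-th component of the surface gradient of `f` at `x ∈ Γ`: the derivative of `f` along `Γ`
in the direction `e_j - n_j n`, the projection of `e_j` on the tangent plane. In tangential
directions the derivative within `Γ` does not depend on any choice; this is the `j`-th partial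
derivative of the extension of `f` which is constant along the normals. -/
def surfPartial (Ω : Set E3) {F : Type*} [NormedAddCommGroup F] [NormedSpace ℝ F]
    (f : E3 → F) (x : E3) (j : Fin 3) : F :=
  fderivWithin ℝ f (frontier Ω) x
    (EuclideanSpace.single j (1 : ℝ) - (normal Ω x j) • normal Ω x)

/-- The surface gradient `∇_Γ φ`. -/
def surfGrad (Ω : Set E3) (φ : E3 → ℂ) (x : E3) : C3 := fun j => surfPartial Ω φ x j

/-- A real matrix acting on `ℂ³`. -/
def act (A : Matrix (Fin 3) (Fin 3) ℝ) (v : C3) : C3 := (A.map (fun t : ℝ => (t : ℂ))) *ᵥ v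

/-- `(A ∇_Γ) · V = ∑ i, (A ∇_Γ V_i)_i` for a matrix field `A`. -/
def matDiv (Ω : Set E3) (A : E3 → Matrix (Fin 3) (Fin 3) ℝ) (V : E3 → C3) (x : E3) : ℂ :=
  ∑ i, act (A x) (surfGrad Ω (fun y => V y i) x) i

/-- The surface divergence `div_Γ V = ∑ i, (∇_Γ V_i)_i` (on tangential fields, minus the
`L²(Γ)`-adjoint of `∇_Γ`). -/
def surfDiv (Ω : Set E3) (V : E3 → C3) (x : E3) : ℂ :=
  ∑ i, surfGrad Ω (fun y => V y i) x i

/-- The scalar surface curl `curl_Γ V = div_Γ (V × n)`. -/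
def surfCurl (Ω : Set E3) (V : E3 → C3) (x : E3) : ℂ :=
  surfDiv Ω (fun y => V y ⨯₃ nC Ω y) x

/-- The vector surface curl `(∇_Γ φ) × n`. -/
def surfVecCurl (Ω : Set E3) (φ : E3 → ℂ) (x : E3) : C3 :=
  surfGrad Ω φ x ⨯₃ nC Ω x

/-! ### Curvature -/

/-- The projection `I_Γ` on the tangent plane. -/
def tangentProj (Ω : Set E3) (x : E3) : Matrix (Fin 3) (Fin 3) ℝ :=
  fun i j => (if i = j then 1 else 0) - normal Ω x i * normal Ω x j

/-- The curvature tensor `𝒞 = ∇_Γ n`, whose `j`-th column is the surface gradient of `n_j`. -/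
def curvature (Ω : Set E3) (x : E3) : Matrix (Fin 3) (Fin 3) ℝ :=
  fun i j => surfPartial Ω (fun y => normal Ω y j) x i

/-- Half of the sum of the principal curvatures of a curvature tensor `A`. -/
def halfTrace (A : Matrix (Fin 3) (Fin 3) ℝ) : ℝ := A.trace / 2

/-- The second elementary symmetric function of the eigenvalues of a curvature tensor `A`. As `A`
has the eigenvalue `0` (in the normal direction) besides the two principal curvatures, this is
the product of the principal curvatures. -/
def secondSymm (A : Matrix (Fin 3) (Fin 3) ℝ) : ℝ := (A.trace ^ 2 - (A * A).trace) / 2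

/-- If the eigenvalues of `A` are `0, c₁, c₂`, then `halfTrace A = (c₁ + c₂) / 2` and
`secondSymm A = c₁ c₂`. -/
theorem halfTrace_secondSymm_eq (A : Matrix (Fin 3) (Fin 3) ℝ) (c₁ c₂ : ℝ)
    (h : ∀ t : ℝ, (Matrix.scalar (Fin 3) t - A).det = t * (t - c₁) * (t - c₂)) :
    halfTrace A = (c₁ + c₂) / 2 ∧ secondSymm A = c₁ * c₂ := by
  have h0 := h 0
  have h1 := h 1
  have h2 := h (-1)
  simp [Matrix.det_fin_three] at h0 h1 h2
  constructor
  · simp only [halfTrace, Matrix.trace_fin_three]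
    linarith
  · simp only [secondSymm, Matrix.trace_fin_three, Matrix.mul_apply, Fin.sum_univ_three]
    linarith

/-- The mean curvature `h = (c₁ + c₂) / 2`. -/
def meanCurv (Ω : Set E3) (x : E3) : ℝ := halfTrace (curvature Ω x)

/-- The Gaussian curvature `g = c₁ c₂`. -/
def gaussCurv (Ω : Set E3) (x : E3) : ℝ := secondSymm (curvature Ω x)

/-- `𝒢 = g I_Γ`. -/
def tensorG (Ω : Set E3) (x : E3) : Matrix (Fin 3) (Fin 3) ℝ :=
  gaussCurv Ω x • tangentProj Ω x

/-- `ℳ = 2 h I_Γ - 𝒞`. -/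
def tensorM (Ω : Set E3) (x : E3) : Matrix (Fin 3) (Fin 3) ℝ :=
  (2 * meanCurv Ω x) • tangentProj Ω x - curvature Ω x

/-- The operator `C_Γ V = (curl_Γ V) n + curl_Γ (V · n) - (𝒞 V) × n`, the middle term being a
vector surface curl. -/
def opC (Ω : Set E3) (V : E3 → C3) (x : E3) : C3 :=
  surfCurl Ω V x • nC Ω x + surfVecCurl Ω (fun y => V y ⬝ᵥ nC Ω y) x
    - act (curvature Ω x) (V x) ⨯₃ nC Ω x

/-- The operator `C_Γ^M V = (curl_Γ^M V) n + curl_Γ^M (V · n) - (𝒢 V) × n`, with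
`curl_Γ^M V = (ℳ ∇_Γ) · (V × n)` for a vector field `V` and `curl_Γ^M φ = (ℳ ∇_Γ φ) × n` for a
scalar field `φ`. -/
def opCM (Ω : Set E3) (V : E3 → C3) (x : E3) : C3 :=
  matDiv Ω (tensorM Ω) (fun y => V y ⨯₃ nC Ω y) x • nC Ω x
    + act (tensorM Ω x) (surfGrad Ω (fun y => V y ⬝ᵥ nC Ω y) x) ⨯₃ nC Ω x
    - act (tensorG Ω x) (V x) ⨯₃ nC Ω x

/-! ### The recursive system -/

/-- `∂_η u` on `η ≥ 0` (one-sided at `η = 0`). -/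
def dEta (u : Profile) : Profile := fun x η => derivWithin (u x) (Set.Ici 0) η

/-- The part `∂_η v × n + u / ω`. -/
def lhsH (Ω : Set E3) (om : ℝ) (u v : Profile) : Profile := fun x η =>
  dEta v x η ⨯₃ nC Ω x + ((1 : ℂ) / om) • u x η

/-- The part `-∂_η u × n + i ω v`. -/
def lhsE (Ω : Set E3) (om : ℝ) (u v : Profile) : Profile := fun x η =>
  -(dEta u x η ⨯₃ nC Ω x) + (Complex.I * om) • v x η

/-- The operators `A_H^{(ℓ)}`, `ℓ = 1, 2, 3, 4`. -/
def opAH (Ω : Set E3) (om εr : ℝ) (l : ℕ) (u v : Profile) : Profile := fun x η =>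
  match l with
  | 1 => opC Ω (fun y => v y η) x - (2 * meanCurv Ω x * η : ℂ) • lhsH Ω om u v x η
  | 2 => -((Complex.I * εr * om) • u x η) + (η : ℂ) • opCM Ω (fun y => v y η) x
          - (gaussCurv Ω x * η ^ 2 : ℂ) • lhsH Ω om u v x η
  | 3 => -((2 * η * meanCurv Ω x * (Complex.I * εr * om)) • u x η)
  | 4 => -((η ^ 2 * gaussCurv Ω x * (Complex.I * εr * om)) • u x η)
  | _ => 0

/-- The operators `A_E^{(ℓ)}`, `ℓ = 1, 2`. -/
def opAE (Ω : Set E3) (om : ℝ) (l : ℕ) (u v : Profile) : Profile := fun x η =>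
  match l with
  | 1 => -opC Ω (fun y => u y η) x
          + (2 * meanCurv Ω x * η : ℂ) • (dEta u x η ⨯₃ nC Ω x - (Complex.I * om) • v x η)
  | 2 => -((η : ℂ) • opCM Ω (fun y => u y η) x)
          + (gaussCurv Ω x * η ^ 2 : ℂ) • (dEta u x η ⨯₃ nC Ω x - (Complex.I * om) • v x η)
  | _ => 0

/-- The term of index `k - l` of a sequence of profiles, which is `0` for a negative index. -/
def lag (F : ℕ → Profile) (k l : ℕ) : Profile := if l ≤ k then F (k - l) else 0

/-- Smoothness of a profile on `Γ × [0, ∞)`. -/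
def IsSmoothProfile (Ω : Set E3) (u : Profile) : Prop :=
  ContDiffOn ℝ ∞ (fun p : E3 × ℝ => u p.1 p.2) (frontier Ω ×ˢ Set.Ici (0 : ℝ))

/-- The sequence `(E k, H k)` of smooth profiles solves the recursive problems with the boundary
data `He k × n` on `Γ`, and is square integrable in `η`. -/
structure IsProfileSolution (Ω : Set E3) (om εr : ℝ) (He : ℕ → E3 → C3)
    (E H : ℕ → Profile) : Prop where
  smooth_E : ∀ k, IsSmoothProfile Ω (E k)
  smooth_H : ∀ k, IsSmoothProfile Ω (H k)
  eq_H : ∀ k, ∀ x ∈ frontier Ω, ∀ η : ℝ, 0 ≤ η →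
    lhsH Ω om (E k) (H k) x η
      = ∑ l ∈ Finset.Icc 1 4, opAH Ω om εr l (lag E k l) (lag H k l) x η
  eq_E : ∀ k, ∀ x ∈ frontier Ω, ∀ η : ℝ, 0 ≤ η →
    lhsE Ω om (E k) (H k) x η
      = ∑ l ∈ Finset.Icc 1 2, opAE Ω om l (lag E k l) (lag H k l) x η
  boundary : ∀ k, ∀ x ∈ frontier Ω, H k x 0 ⨯₃ nC Ω x = He k x ⨯₃ nC Ω x
  integrable_H : ∀ k, ∀ x ∈ frontier Ω,
    MeasureTheory.IntegrableOn (fun η : ℝ => ∑ j, ‖H k x η j‖ ^ 2) (Set.Ioi 0)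
  integrable_E : ∀ k, ∀ x ∈ frontier Ω,
    MeasureTheory.IntegrableOn (fun η : ℝ => ∑ j, ‖E k x η j‖ ^ 2) (Set.Ioi 0)

/-- The square root `√i = (√2 / 2) (1 + i)`. -/
def sqrtI : ℂ := ((√2 / 2 : ℝ) : ℂ) * (1 + Complex.I)

/-- `P_k(Γ, ℝ⁺; ℂ³)`: on `Γ × [0, ∞)`, `u` is a polynomial in `η` of degree at most `k` with
coefficients in `C^∞(Γ; ℂ³)`. -/
def IsPolyProfile (Ω : Set E3) (k : ℕ) (u : Profile) : Prop :=
  ∃ a : ℕ → E3 → C3, (∀ j, ContDiffOn ℝ ∞ (a j) (frontier Ω)) ∧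
    ∀ x ∈ frontier Ω, ∀ η : ℝ, 0 ≤ η →
      u x η = ∑ j ∈ Finset.range (k + 1), ((η : ℂ) ^ j) • a j x

end BoundaryLayer

end

open Filter Topology

namespace BoundaryLayer

/-! ### Local structure of the boundary -/

/-! At each order `k` the equations are linear ordinary differential equations in `η`, with the
boundary point as a parameter and a right-hand side built from earlier orders. Taking the dot
product with `n` gives the normal components algebraically. Eliminating the electric profile from
the tangential part leaves `w'' - i w = r` for the tangential part `w` of the magnetic profile,
whose homogeneous solutions are `e^{±√i η}`. The boundary datum fixes the decaying solution.

Existence rests on a count of terms. If the right-hand side is `e^{-√i η}` times a polynomial with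
`k` terms, the solution has `k + 1` terms (`exists_coeff_secondOrder`,
`IsSmoothBoundedDomain.exists_coeff`). The factors `η` and `η²` in the operators would break this
count, but they multiply the left-hand sides of earlier equations, which have one term fewer than
the profiles themselves. Hence operator `l` applied at order `k - l` yields at most `k` terms
(`isExpPoly_opAH`, `isExpPoly_opAE`), and the induction closes.

Uniqueness needs no explicit solutions. For a difference of two solutions, the squared modulus of
each magnetic component starts at zero and is nondecreasing, so integrability makes it vanish
(`eq_zero_of_squareIntegrable`).

Smoothness of the coefficients requires surface derivatives to be well defined and to preserve
smoothness on `Γ`. Both follow from straightening the boundary (`exists_straightening`), which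
provides curves in `Γ` with any tangent velocity and a local smooth retraction onto `Γ`. -/

theorem inner_gradient (ρ : E3 → ℝ) (x v : E3) : inner ℝ (gradient ρ x) v = fderiv ℝ ρ x v := by
  simp [gradient]

theorem IsLocalDefiningFunction.contDiffAt {Ω : Set E3} {x : E3} {U : Set E3} {ρ : E3 → ℝ}
    (h : IsLocalDefiningFunction Ω x U ρ) {y : E3} (hy : y ∈ U) : ContDiffAt ℝ ∞ ρ y :=
  (h.contDiffOn y hy).contDiffAt (h.isOpen.mem_nhds hy)

theorem IsLocalDefiningFunction.of_mem {Ω : Set E3} {x : E3} {U : Set E3} {ρ : E3 → ℝ}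
    (h : IsLocalDefiningFunction Ω x U ρ) {y : E3} (hy : y ∈ U) :
    IsLocalDefiningFunction Ω y U ρ :=
  ⟨h.isOpen, hy, h.contDiffOn, h.gradient_ne_zero, h.mem_iff, h.mem_frontier_iff⟩

/-- Near a boundary point `x`, the boundary is straightened by a local diffeomorphism tangent to
the identity at `x`; this gives a smooth local parametrization by the tangent plane and a smooth
local retraction on the boundary. -/
theorem IsLocalDefiningFunction.exists_straightening {Ω : Set E3} {x : E3} {U : Set E3}
    {ρ : E3 → ℝ} (h : IsLocalDefiningFunction Ω x U ρ) (hx : x ∈ frontier Ω) :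
    ∃ Ψ r : E3 → E3, Ψ x = x ∧ HasFDerivAt Ψ (ContinuousLinearMap.id ℝ E3) x ∧
      (∀ᶠ z in 𝓝 x, inner ℝ (gradient ρ x) (z - x) = 0 → Ψ z ∈ frontier Ω) ∧
      r x = x ∧ ContDiffAt ℝ ∞ r x ∧ (∀ᶠ y in 𝓝 x, r y ∈ frontier Ω) ∧
      ∀ᶠ y in 𝓝[frontier Ω] x, r y = y := by
  set g := gradient ρ x with hg
  have hg0 : g ≠ 0 := h.gradient_ne_zero x h.mem
  have hgg : (inner ℝ g g : ℝ) ≠ 0 := inner_self_ne_zero.2 hg0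
  set ν : E3 := (inner ℝ g g : ℝ)⁻¹ • g with hν
  have hgν : inner ℝ g ν = (1 : ℝ) := by
    rw [hν, inner_smul_right, inv_mul_cancel₀ hgg]
  have hρx : ρ x = 0 := (h.mem_frontier_iff x h.mem).1 hx
  have hρ := h.contDiffAt h.mem
  -- The correction along `ν` makes the height of `Φ y` over the tangent plane equal to `ρ y`. It
  -- vanishes to first order at `x`, so `Φ` has identity derivative there and is locally invertible.
  set Φ : E3 → E3 := fun y => y + (ρ y - inner ℝ g (y - x)) • ν with hΦ
  have hΦx : Φ x = x := by simp [hΦ, hρx]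
  have hΦg : ∀ y, inner ℝ g (Φ y - x) = ρ y := by
    intro y
    have : Φ y - x = (y - x) + (ρ y - inner ℝ g (y - x)) • ν := by simp only [hΦ]; abel
    rw [this, inner_add_right, inner_smul_right, hgν]
    ring
  have hΦs : ContDiffAt ℝ ∞ Φ x := by
    refine contDiffAt_id.add (ContDiffAt.smul (hρ.sub ?_) contDiffAt_const)
    exact contDiffAt_const.inner ℝ (contDiffAt_id.sub contDiffAt_const)
  have hρd : HasFDerivAt ρ (innerSL ℝ g) x := by
    have h1 : HasFDerivAt ρ (fderiv ℝ ρ x) x :=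
      (hρ.differentiableAt (by simp)).hasFDerivAt
    convert! h1 using 1
    ext v
    simp [hg]
  have hΦd : HasFDerivAt Φ ((ContinuousLinearEquiv.refl ℝ E3 : E3 ≃L[ℝ] E3) : E3 →L[ℝ] E3) x := by
    have h1 : HasFDerivAt (fun y : E3 => inner ℝ g (y - x)) (innerSL ℝ g) x :=
      ((innerSL ℝ g).hasFDerivAt).comp x ((hasFDerivAt_id x).sub_const x)
    have h2 := (hasFDerivAt_id x).add ((hρd.sub h1).smul_const ν)
    convert! h2 using 1
    ext v
    simp
  have hn : (∞ : WithTop ℕ∞) ≠ 0 := by simp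
  set Ψ := hΦs.localInverse hΦd hn with hΨ
  have hΨx : Ψ x = x := by
    have := hΦs.localInverse_apply_image hΦd hn
    rwa [hΦx] at this
  have hΨs : ContDiffAt ℝ ∞ Ψ x := by
    have := hΦs.to_localInverse hΦd hn
    rwa [hΦx] at this
  have hst := hΦs.hasStrictFDerivAt' hΦd hn
  have hΨd : HasFDerivAt Ψ (ContinuousLinearMap.id ℝ E3) x := by
    have := hst.to_localInverse.hasFDerivAt
    rw [hΦx] at this
    exact this
  have hR : ∀ᶠ z in 𝓝 x, Φ (Ψ z) = z := by
    have := hst.eventually_right_inverse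
    rwa [hΦx] at this
  have hLft : ∀ᶠ y in 𝓝 x, Ψ (Φ y) = y := hst.eventually_left_inverse
  have hU : ∀ᶠ z in 𝓝 x, Ψ z ∈ U := by
    have : Tendsto Ψ (𝓝 x) (𝓝 x) := by
      have := hΨs.continuousAt.tendsto
      rwa [hΨx] at this
    exact this.eventually (h.isOpen.mem_nhds h.mem)
  have hplane : ∀ᶠ z in 𝓝 x, inner ℝ g (z - x) = 0 → Ψ z ∈ frontier Ω := by
    filter_upwards [hR, hU] with z hz1 hz2 hz3
    rw [h.mem_frontier_iff _ hz2, ← hΦg, hz1, hz3]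
  -- Straighten, then project onto the tangent plane along `ν`. Composing with `Ψ` gives the
  -- retraction, since the projection does nothing where `ρ = 0`.
  set τ : E3 → E3 := fun y => Φ y - ρ y • ν with hτ
  have hτx : τ x = x := by simp [hτ, hΦx, hρx]
  have hτs : ContDiffAt ℝ ∞ τ x := hΦs.sub (hρ.smul contDiffAt_const)
  refine ⟨Ψ, fun y => Ψ (τ y), hΨx, hΨd, hplane, by simp only [hτx, hΨx], ?_, ?_, ?_⟩
  · exact ContDiffAt.comp x (by rwa [hτx]) hτs
  · have : Tendsto τ (𝓝 x) (𝓝 x) := by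
      have := hτs.continuousAt.tendsto
      rwa [hτx] at this
    filter_upwards [this.eventually hplane] with y hy
    apply hy
    have : τ y - x = (Φ y - x) - ρ y • ν := by simp only [hτ]; abel
    rw [this, inner_sub_right, hΦg, inner_smul_right, hgν]
    ring
  · filter_upwards [nhdsWithin_le_nhds hLft, self_mem_nhdsWithin,
      nhdsWithin_le_nhds (h.isOpen.mem_nhds h.mem)] with y hy1 hy2 hy3
    have : ρ y = 0 := (h.mem_frontier_iff y hy3).1 hy2
    simp [hτ, this, hy1]

/-- Every vector orthogonal to the gradient of a defining function is the velocity of a curve in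
the boundary. -/
theorem IsLocalDefiningFunction.exists_curve {Ω : Set E3} {x : E3} {U : Set E3}
    {ρ : E3 → ℝ} (h : IsLocalDefiningFunction Ω x U ρ) (hx : x ∈ frontier Ω) {v : E3}
    (hv : inner ℝ (gradient ρ x) v = 0) :
    ∃ γ : ℝ → E3, γ 0 = x ∧ HasDerivAt γ v 0 ∧ ∀ᶠ t in 𝓝 0, γ t ∈ frontier Ω := by
  obtain ⟨Ψ, -, hΨx, hΨd, hpl, -⟩ := h.exists_straightening hx
  have hl : HasDerivAt (fun t : ℝ => x + t • v) v 0 := by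
    simpa using ((hasDerivAt_id (0 : ℝ)).smul_const v).const_add x
  refine ⟨fun t => Ψ (x + t • v), by simp [hΨx], ?_, ?_⟩
  · have h0 : HasFDerivAt Ψ (ContinuousLinearMap.id ℝ E3) (x + (0 : ℝ) • v) := by simpa using hΨd
    exact h0.comp_hasDerivAt (0 : ℝ) hl
  · have : Tendsto (fun t : ℝ => x + t • v) (𝓝 0) (𝓝 x) := by
      simpa using hl.continuousAt.tendsto
    filter_upwards [this.eventually hpl] with t ht
    apply ht
    simp [inner_smul_right, hv]

/-- A surface determines a derivative within it only in tangential directions: along a curve in the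
boundary with velocity `v`, both candidates compute the same one-variable derivative. -/
theorem IsLocalDefiningFunction.fderivWithin_unique {Ω : Set E3} {x : E3} {U : Set E3}
    {ρ : E3 → ℝ} (h : IsLocalDefiningFunction Ω x U ρ) (hx : x ∈ frontier Ω) {v : E3}
    (hv : inner ℝ (gradient ρ x) v = 0) {F : Type*} [NormedAddCommGroup F] [NormedSpace ℝ F]
    {f : E3 → F} {L₁ L₂ : E3 →L[ℝ] F} (h₁ : HasFDerivWithinAt f L₁ (frontier Ω) x)
    (h₂ : HasFDerivWithinAt f L₂ (frontier Ω) x) : L₁ v = L₂ v := by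
  obtain ⟨γ, h0, hγ, hmem⟩ := h.exists_curve hx hv
  rw [← h0] at h₁ h₂
  exact (h₁.comp_hasDerivAt 0 hγ hmem).unique (h₂.comp_hasDerivAt 0 hγ hmem)

/-! ### The normal -/

/-- A function with a zero and nonnegative values to the right of it has nonnegative derivative
there. -/
theorem deriv_nonneg_of_eventually {f : ℝ → ℝ} {f' : ℝ} (hf : HasDerivAt f f' 0) (h0 : f 0 = 0)
    (hpos : ∀ᶠ t in 𝓝[>] 0, 0 ≤ f t) : 0 ≤ f' := by
  have h1 := (hasDerivAt_iff_tendsto_slope_zero.1 hf).mono_left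
    (nhdsWithin_mono (0 : ℝ) (fun t (ht : t ∈ Set.Ioi 0) => ne_of_gt ht))
  refine ge_of_tendsto h1 ?_
  filter_upwards [hpos, self_mem_nhdsWithin] with t ht ht0
  have : (0 : ℝ) < t := ht0
  simp only [zero_add, h0, sub_zero, smul_eq_mul]
  positivity

theorem IsLocalDefiningFunction.hasDerivAt_line {Ω : Set E3} {x : E3} {U : Set E3}
    {ρ : E3 → ℝ} (h : IsLocalDefiningFunction Ω x U ρ) (v : E3) :
    HasDerivAt (fun t : ℝ => ρ (x + t • v)) (inner ℝ (gradient ρ x) v) 0 := by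
  have hl : HasDerivAt (fun t : ℝ => x + t • v) v 0 := by
    simpa using ((hasDerivAt_id (0 : ℝ)).smul_const v).const_add x
  have h1 : HasFDerivAt ρ (fderiv ℝ ρ x) (x + (0 : ℝ) • v) := by
    simpa using ((h.contDiffAt h.mem).differentiableAt (by simp)).hasFDerivAt
  rw [inner_gradient]
  exact h1.comp_hasDerivAt (0 : ℝ) hl

/-- Both gradients are orthogonal to the velocities of curves in the boundary, hence parallel. The
factor is positive because moving against the first gradient enters `Ω`, where the second function
is negative too. -/
theorem normal_direction_unique {Ω : Set E3} {x : E3} {U₁ U₂ : Set E3} {ρ₁ ρ₂ : E3 → ℝ}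
    (h₁ : IsLocalDefiningFunction Ω x U₁ ρ₁) (h₂ : IsLocalDefiningFunction Ω x U₂ ρ₂)
    (hx : x ∈ frontier Ω) :
    (‖gradient ρ₁ x‖)⁻¹ • gradient ρ₁ x = (‖gradient ρ₂ x‖)⁻¹ • gradient ρ₂ x := by
  set a := gradient ρ₁ x with ha
  set b := gradient ρ₂ x with hb
  have ha0 : a ≠ 0 := h₁.gradient_ne_zero x h₁.mem
  have hb0 : b ≠ 0 := h₂.gradient_ne_zero x h₂.mem
  have haa : (0 : ℝ) < inner ℝ a a := real_inner_self_pos.2 ha0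
  have hperp : ∀ v : E3, inner ℝ a v = 0 → inner ℝ b v = 0 := by
    intro v hv
    obtain ⟨γ, h0, hγ, hmem⟩ := h₁.exists_curve hx hv
    have hγU : ∀ᶠ t in 𝓝 0, γ t ∈ U₂ := by
      have := hγ.continuousAt.tendsto
      rw [h0] at this
      exact this.eventually (h₂.isOpen.mem_nhds h₂.mem)
    have hd : HasDerivAt (ρ₂ ∘ γ) (fderiv ℝ ρ₂ x v) 0 := by
      have h1 : HasFDerivAt ρ₂ (fderiv ℝ ρ₂ x) (γ 0) := by
        rw [h0]
        exact ((h₂.contDiffAt h₂.mem).differentiableAt (by simp)).hasFDerivAt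
      exact h1.comp_hasDerivAt (0 : ℝ) hγ
    have hz : (ρ₂ ∘ γ) =ᶠ[𝓝 0] fun _ => (0 : ℝ) := by
      filter_upwards [hmem, hγU] with t h3 h4
      exact (h₂.mem_frontier_iff _ h4).1 h3
    rw [hb, inner_gradient]
    exact hd.unique ((hasDerivAt_const 0 (0 : ℝ)).congr_of_eventuallyEq hz)
  -- The remainder `b - c • a` is orthogonal to `a`, hence to `b`, hence to itself.
  set c : ℝ := inner ℝ b a / inner ℝ a a with hc
  have hbc : b = c • a := by
    have h3 : inner ℝ a (b - c • a) = 0 := by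
      rw [inner_sub_right, inner_smul_right, hc, div_mul_cancel₀ _ haa.ne', real_inner_comm, sub_self]
    have h4 := hperp _ h3
    have h5 : inner ℝ (b - c • a) (b - c • a) = (0 : ℝ) := by
      rw [inner_sub_left, inner_smul_left, h4, h3]
      simp
    exact sub_eq_zero.1 (inner_self_eq_zero.1 h5)
  have hc0 : c ≠ 0 := by
    rintro h0
    exact hb0 (by rw [hbc, h0, zero_smul])
  have hρ₁ : ρ₁ x = 0 := (h₁.mem_frontier_iff x h₁.mem).1 hx
  have hρ₂ : ρ₂ x = 0 := (h₂.mem_frontier_iff x h₂.mem).1 hx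
  have hsign : 0 ≤ inner ℝ b a := by
    have hd₁ := h₁.hasDerivAt_line (-a)
    have hd₂ := (h₂.hasDerivAt_line (-a)).neg
    rw [← ha, inner_neg_right] at hd₁
    rw [← hb, inner_neg_right, neg_neg] at hd₂
    refine deriv_nonneg_of_eventually hd₂ (by simp [hρ₂]) ?_
    have hneg : ∀ᶠ t : ℝ in 𝓝[>] 0, ρ₁ (x + t • -a) < 0 := by
      have h1 := (hasDerivAt_iff_tendsto_slope_zero.1 hd₁).mono_left
        (nhdsWithin_mono (0 : ℝ) (fun t (ht : t ∈ Set.Ioi 0) => ne_of_gt ht))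
      filter_upwards [h1.eventually (gt_mem_nhds (neg_lt_zero.2 haa)), self_mem_nhdsWithin]
        with t ht ht0
      have ht0 : (0 : ℝ) < t := ht0
      simp only [zero_add, zero_smul, add_zero, hρ₁, sub_zero, smul_eq_mul] at ht
      by_contra hcon
      push Not at hcon
      have : 0 ≤ t⁻¹ * ρ₁ (x + t • -a) := by positivity
      linarith
    have hl : Tendsto (fun t : ℝ => x + t • -a) (𝓝[>] 0) (𝓝 x) := by
      have : Continuous fun t : ℝ => x + t • -a := by fun_prop
      have := this.tendsto 0
      simp only [zero_smul, add_zero] at this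
      exact this.mono_left nhdsWithin_le_nhds
    filter_upwards [hneg, hl.eventually (h₁.isOpen.mem_nhds h₁.mem),
      hl.eventually (h₂.isOpen.mem_nhds h₂.mem)] with t h3 h4 h5
    have := (h₂.mem_iff _ h5).1 ((h₁.mem_iff _ h4).2 h3)
    simp only [Pi.neg_apply]
    linarith
  have hcpos : 0 < c := lt_of_le_of_ne (div_nonneg hsign haa.le) (Ne.symm hc0)
  rw [hbc, norm_smul, Real.norm_of_nonneg hcpos.le, smul_smul]
  congr 1
  have : ‖a‖ ≠ 0 := norm_ne_zero_iff.2 ha0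
  field_simp

/-- Uniqueness of the direction makes the choice inside `normal` harmless, so any convenient `ρ` can
be used to compute it. -/
theorem IsLocalDefiningFunction.normal_eq {Ω : Set E3} {x : E3} {U : Set E3} {ρ : E3 → ℝ}
    (h : IsLocalDefiningFunction Ω x U ρ) (hx : x ∈ frontier Ω) :
    normal Ω x = -((‖gradient ρ x‖)⁻¹ • gradient ρ x) := by
  have hex : x ∈ frontier Ω ∧ ∃ v, IsInwardUnitNormal Ω x v := ⟨hx, _, U, ρ, h, rfl⟩
  rw [normal, dif_pos hex]
  obtain ⟨U', ρ', h', hv⟩ := hex.2.choose_spec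
  rw [hv, normal_direction_unique h' h hx]

theorem IsSmoothBoundedDomain.norm_normal {Ω : Set E3} (hΩ : IsSmoothBoundedDomain Ω) {x : E3}
    (hx : x ∈ frontier Ω) : ‖normal Ω x‖ = 1 := by
  obtain ⟨U, ρ, h⟩ := hΩ.smooth x hx
  have : ‖gradient ρ x‖ ≠ 0 := norm_ne_zero_iff.2 (h.gradient_ne_zero x h.mem)
  rw [h.normal_eq hx, norm_neg, norm_smul, norm_inv, norm_norm, inv_mul_cancel₀ this]

/-- One `ρ` serves at all nearby boundary points, so its normalized gradient is a smooth local
extension of `n`. -/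
theorem IsSmoothBoundedDomain.contDiffOn_normal {Ω : Set E3} (hΩ : IsSmoothBoundedDomain Ω) :
    ContDiffOn ℝ ∞ (normal Ω) (frontier Ω) := by
  intro x hx
  obtain ⟨U, ρ, h⟩ := hΩ.smooth x hx
  have hgr : ContDiffAt ℝ ∞ (gradient ρ) x := by
    have h1 : ContDiffAt ℝ ∞ (fderiv ℝ ρ) x := (h.contDiffAt h.mem).fderiv_right (by simp)
    exact (InnerProductSpace.toDual ℝ E3).symm.contDiff.contDiffAt.comp x h1
  have h0 := h.gradient_ne_zero x h.mem
  have hs : ContDiffAt ℝ ∞ (fun y => -((‖gradient ρ y‖)⁻¹ • gradient ρ y)) x :=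
    (((hgr.norm ℝ h0).inv (norm_ne_zero_iff.2 h0)).smul hgr).neg
  refine hs.contDiffWithinAt.congr_of_eventuallyEq ?_ (h.normal_eq hx)
  filter_upwards [self_mem_nhdsWithin, nhdsWithin_le_nhds (h.isOpen.mem_nhds h.mem)] with y h3 h4
  exact (h.of_mem h4).normal_eq h3

/-! ### Surface derivatives -/

/-- Derivatives within the boundary agree on the projections of the coordinate vectors on the
tangent plane. -/
theorem IsSmoothBoundedDomain.surfPartial_eq {Ω : Set E3} (hΩ : IsSmoothBoundedDomain Ω) {x : E3}
    (hx : x ∈ frontier Ω) {F : Type*} [NormedAddCommGroup F] [NormedSpace ℝ F] {f : E3 → F}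
    {L : E3 →L[ℝ] F} (hL : HasFDerivWithinAt f L (frontier Ω) x) (j : Fin 3) :
    surfPartial Ω f x j
      = L (EuclideanSpace.single j (1 : ℝ) - (normal Ω x j) • normal Ω x) := by
  obtain ⟨U, ρ, h⟩ := hΩ.smooth x hx
  refine h.fderivWithin_unique hx ?_ hL.differentiableWithinAt.hasFDerivWithinAt hL
  have h0 : ‖gradient ρ x‖ ≠ 0 := norm_ne_zero_iff.2 (h.gradient_ne_zero x h.mem)
  rw [h.normal_eq hx, inner_sub_right, EuclideanSpace.inner_single_right]
  simp only [inner_smul_right, inner_neg_right, real_inner_self_eq_norm_sq, PiLp.neg_apply,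
    PiLp.smul_apply, smul_eq_mul]
  simp
  field_simp
  ring

theorem surfPartial_congr {Ω : Set E3} {x : E3} (hx : x ∈ frontier Ω) {F : Type*}
    [NormedAddCommGroup F] [NormedSpace ℝ F] {f g : E3 → F} (h : Set.EqOn f g (frontier Ω))
    (j : Fin 3) : surfPartial Ω f x j = surfPartial Ω g x j := by
  rw [surfPartial, surfPartial, fderivWithin_congr h (h hx)]

theorem IsSmoothBoundedDomain.surfPartial_add {Ω : Set E3} (hΩ : IsSmoothBoundedDomain Ω) {x : E3}
    (hx : x ∈ frontier Ω) {F : Type*} [NormedAddCommGroup F] [NormedSpace ℝ F] {f g : E3 → F}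
    (hf : DifferentiableWithinAt ℝ f (frontier Ω) x)
    (hg : DifferentiableWithinAt ℝ g (frontier Ω) x) (j : Fin 3) :
    surfPartial Ω (fun y => f y + g y) x j = surfPartial Ω f x j + surfPartial Ω g x j := by
  exact hΩ.surfPartial_eq hx (hf.hasFDerivWithinAt.add hg.hasFDerivWithinAt) j

theorem IsSmoothBoundedDomain.surfPartial_const_mul {Ω : Set E3} (hΩ : IsSmoothBoundedDomain Ω)
    {x : E3} (hx : x ∈ frontier Ω) {f : E3 → ℂ}
    (hf : DifferentiableWithinAt ℝ f (frontier Ω) x) (c : ℂ) (j : Fin 3) :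
    surfPartial Ω (fun y => c * f y) x j = c * surfPartial Ω f x j := by
  rw [hΩ.surfPartial_eq hx (hf.hasFDerivWithinAt.const_mul c)]
  rfl

/-- A smooth function on the boundary has a local extension which is smooth at a given point. -/
theorem IsSmoothBoundedDomain.exists_extension {Ω : Set E3} (hΩ : IsSmoothBoundedDomain Ω) {x : E3}
    (hx : x ∈ frontier Ω) {F : Type*} [NormedAddCommGroup F] [NormedSpace ℝ F] {f : E3 → F}
    (hf : ContDiffWithinAt ℝ ∞ f (frontier Ω) x) :
    ∃ f' : E3 → F, ContDiffAt ℝ ∞ f' x ∧ f =ᶠ[𝓝[frontier Ω] x] f' := by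
  obtain ⟨U, ρ, h⟩ := hΩ.smooth x hx
  obtain ⟨-, r, -, -, -, hrx, hr, hmem, hid⟩ := h.exists_straightening hx
  refine ⟨f ∘ r, ?_, ?_⟩
  · have h1 : ContDiffWithinAt ℝ ∞ (f ∘ r) (r ⁻¹' frontier Ω) x :=
      ContDiffWithinAt.comp x (by rwa [hrx]) hr.contDiffWithinAt (fun y hy => hy)
    exact h1.contDiffAt hmem
  · filter_upwards [hid] with y hy
    simp [hy]

theorem IsSmoothBoundedDomain.contDiffOn_surfPartial {Ω : Set E3} (hΩ : IsSmoothBoundedDomain Ω)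
    {F : Type*} [NormedAddCommGroup F] [NormedSpace ℝ F] {f : E3 → F}
    (hf : ContDiffOn ℝ ∞ f (frontier Ω)) (j : Fin 3) :
    ContDiffOn ℝ ∞ (fun x => surfPartial Ω f x j) (frontier Ω) := by
  intro x hx
  obtain ⟨f', hf', heq⟩ := hΩ.exists_extension hx (hf x hx)
  have hn := hΩ.contDiffOn_normal
  have key : ∀ y ∈ frontier Ω, f =ᶠ[𝓝[frontier Ω] y] f' → ContDiffAt ℝ 1 f' y →
      surfPartial Ω f y j
        = fderiv ℝ f' y (EuclideanSpace.single j (1 : ℝ) - (normal Ω y j) • normal Ω y) := by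
    intro y hy h1 h2
    have h3 := (h2.differentiableAt (by simp)).hasFDerivAt.hasFDerivWithinAt (s := frontier Ω)
    exact hΩ.surfPartial_eq hy (h3.congr_of_eventuallyEq h1 (h1.eq_of_nhdsWithin hy)) j
  -- Being `C^1` at a point persists nearby, unlike being `C^∞` at a point, and `C^1` suffices to
  -- compute the surface derivative through `f'`.
  have h1 : ContDiffAt ℝ 1 f' x := hf'.of_le (by exact_mod_cast le_top)
  have hfd : ContDiffAt ℝ ∞ (fderiv ℝ f') x := hf'.fderiv_right (by simp)
  have hnj : ContDiffWithinAt ℝ ∞ (fun y => normal Ω y j) (frontier Ω) x :=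
    contDiffWithinAt_euclidean.1 (hn x hx) j
  have hs := hfd.contDiffWithinAt.clm_apply
    ((contDiffWithinAt_const (c := (EuclideanSpace.single j (1 : ℝ) : E3))).sub
      (hnj.smul (hn x hx)))
  refine hs.congr_of_eventuallyEq ?_ (key x hx heq h1)
  filter_upwards [self_mem_nhdsWithin, eventually_eventually_nhdsWithin.2 heq,
    nhdsWithin_le_nhds (h1.eventually (by simp))] with y h3 h4 h5
  exact key y h3 h4 h5

/-! ### Smooth fields and surface operators -/

section Smooth

variable {M : Type*} [NormedAddCommGroup M] [NormedSpace ℝ M] {s : Set M}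

theorem contDiffOn_cross {u v : M → C3} (hu : ContDiffOn ℝ ∞ u s) (hv : ContDiffOn ℝ ∞ v s) :
    ContDiffOn ℝ ∞ (fun x => u x ⨯₃ v x) s := by
  rw [contDiffOn_pi] at hu hv ⊢
  intro i
  fin_cases i <;> simp only [cross_apply] <;>
    exact ((hu _).mul (hv _)).sub ((hu _).mul (hv _))

theorem contDiffOn_dot {u v : M → C3} (hu : ContDiffOn ℝ ∞ u s) (hv : ContDiffOn ℝ ∞ v s) :
    ContDiffOn ℝ ∞ (fun x => u x ⬝ᵥ v x) s := by
  rw [contDiffOn_pi] at hu hv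
  simp only [dotProduct]
  exact ContDiffOn.sum fun i _ => (hu i).mul (hv i)

theorem contDiffOn_ofReal {f : M → ℝ} (hf : ContDiffOn ℝ ∞ f s) :
    ContDiffOn ℝ ∞ (fun x => (f x : ℂ)) s :=
  Complex.ofRealCLM.contDiff.comp_contDiffOn hf

theorem contDiffOn_act {A : M → Matrix (Fin 3) (Fin 3) ℝ} {u : M → C3}
    (hA : ∀ i j, ContDiffOn ℝ ∞ (fun x => A x i j) s) (hu : ContDiffOn ℝ ∞ u s) :
    ContDiffOn ℝ ∞ (fun x => act (A x) (u x)) s := by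
  rw [contDiffOn_pi] at hu ⊢
  intro i
  simp only [act, Matrix.mulVec, dotProduct, Matrix.map_apply]
  exact ContDiffOn.sum fun j _ => (contDiffOn_ofReal (hA i j)).mul (hu j)

theorem contDiffOn_trace {A : M → Matrix (Fin 3) (Fin 3) ℝ}
    (hA : ∀ i j, ContDiffOn ℝ ∞ (fun x => A x i j) s) :
    ContDiffOn ℝ ∞ (fun x => (A x).trace) s := by
  simp only [Matrix.trace, Matrix.diag]
  exact ContDiffOn.sum fun i _ => hA i i

end Smooth

namespace IsSmoothBoundedDomain

variable {Ω : Set E3} (hΩ : IsSmoothBoundedDomain Ω)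

include hΩ

theorem contDiffOn_normal_apply (j : Fin 3) :
    ContDiffOn ℝ ∞ (fun x => normal Ω x j) (frontier Ω) :=
  contDiffOn_euclidean.1 hΩ.contDiffOn_normal j

theorem contDiffOn_nC : ContDiffOn ℝ ∞ (nC Ω) (frontier Ω) :=
  contDiffOn_pi.2 fun j => contDiffOn_ofReal (hΩ.contDiffOn_normal_apply j)

theorem contDiffOn_tangentProj (i j : Fin 3) :
    ContDiffOn ℝ ∞ (fun x => tangentProj Ω x i j) (frontier Ω) :=
  contDiffOn_const.sub ((hΩ.contDiffOn_normal_apply i).mul (hΩ.contDiffOn_normal_apply j))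

theorem contDiffOn_curvature (i j : Fin 3) :
    ContDiffOn ℝ ∞ (fun x => curvature Ω x i j) (frontier Ω) :=
  hΩ.contDiffOn_surfPartial (hΩ.contDiffOn_normal_apply j) i

theorem contDiffOn_meanCurv : ContDiffOn ℝ ∞ (meanCurv Ω) (frontier Ω) :=
  (contDiffOn_trace hΩ.contDiffOn_curvature).div_const 2

theorem contDiffOn_gaussCurv : ContDiffOn ℝ ∞ (gaussCurv Ω) (frontier Ω) := by
  refine (((contDiffOn_trace hΩ.contDiffOn_curvature).pow 2).sub
    (contDiffOn_trace fun i j => ?_)).div_const 2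
  simp only [Matrix.mul_apply]
  exact ContDiffOn.sum fun k _ => (hΩ.contDiffOn_curvature i k).mul (hΩ.contDiffOn_curvature k j)

theorem contDiffOn_tensorG (i j : Fin 3) :
    ContDiffOn ℝ ∞ (fun x => tensorG Ω x i j) (frontier Ω) :=
  hΩ.contDiffOn_gaussCurv.mul (hΩ.contDiffOn_tangentProj i j)

theorem contDiffOn_tensorM (i j : Fin 3) :
    ContDiffOn ℝ ∞ (fun x => tensorM Ω x i j) (frontier Ω) :=
  ((contDiffOn_const.mul hΩ.contDiffOn_meanCurv).mul (hΩ.contDiffOn_tangentProj i j)).sub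
    (hΩ.contDiffOn_curvature i j)

end IsSmoothBoundedDomain

/-! ### Linear surface operators. -/

/-- A local `ℂ`-linear operator on vector fields on the boundary which preserves smoothness. -/
structure IsSurfaceOperator (Ω : Set E3) {G : Type*} [NormedAddCommGroup G] [NormedSpace ℂ G]
    (T : (E3 → C3) → E3 → G) : Prop where
  congr : ∀ V W, Set.EqOn V W (frontier Ω) → Set.EqOn (T V) (T W) (frontier Ω)
  add : ∀ V W, ContDiffOn ℝ ∞ V (frontier Ω) → ContDiffOn ℝ ∞ W (frontier Ω) →
    ∀ x ∈ frontier Ω, T (fun y => V y + W y) x = T V x + T W x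
  smul : ∀ (c : ℂ) V, ContDiffOn ℝ ∞ V (frontier Ω) →
    ∀ x ∈ frontier Ω, T (fun y => c • V y) x = c • T V x
  smooth : ∀ V, ContDiffOn ℝ ∞ V (frontier Ω) → ContDiffOn ℝ ∞ (T V) (frontier Ω)

namespace IsSurfaceOperator

variable {Ω : Set E3} {G : Type*} [NormedAddCommGroup G] [NormedSpace ℂ G]

theorem id : IsSurfaceOperator Ω fun V x => V x :=
  ⟨fun _ _ h => h, fun _ _ _ _ _ _ => rfl, fun _ _ _ _ _ => rfl, fun _ h => h⟩

theorem map {T : (E3 → C3) → E3 → G} (hT : IsSurfaceOperator Ω T) {G' : Type*}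
    [NormedAddCommGroup G'] [NormedSpace ℂ G'] (B : E3 → G → G')
    (hadd : ∀ x a b, B x (a + b) = B x a + B x b) (hsmul : ∀ x (c : ℂ) a, B x (c • a) = c • B x a)
    (hsm : ∀ φ, ContDiffOn ℝ ∞ φ (frontier Ω) →
      ContDiffOn ℝ ∞ (fun x => B x (φ x)) (frontier Ω)) :
    IsSurfaceOperator Ω fun V x => B x (T V x) where
  congr V W h x hx := congrArg (B x) (hT.congr V W h hx)
  add V W hV hW x hx := by rw [hT.add V W hV hW x hx, hadd]
  smul c V hV x hx := by rw [hT.smul c V hV x hx, hsmul]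
  smooth V hV := hsm _ (hT.smooth V hV)

theorem add_op {S T : (E3 → C3) → E3 → G} (hS : IsSurfaceOperator Ω S)
    (hT : IsSurfaceOperator Ω T) : IsSurfaceOperator Ω fun V x => S V x + T V x where
  congr V W h x hx := by
    change S V x + T V x = S W x + T W x
    rw [hS.congr V W h hx, hT.congr V W h hx]
  add V W hV hW x hx := by rw [hS.add V W hV hW x hx, hT.add V W hV hW x hx]; abel
  smul c V hV x hx := by rw [hS.smul c V hV x hx, hT.smul c V hV x hx, smul_add]
  smooth V hV := (hS.smooth V hV).add (hT.smooth V hV)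

theorem neg_op {T : (E3 → C3) → E3 → G} (hT : IsSurfaceOperator Ω T) :
    IsSurfaceOperator Ω fun V x => -T V x :=
  hT.map (fun _ a => -a) (fun _ a b => neg_add a b) (fun _ c a => (smul_neg c a).symm)
    fun _ h => h.neg

theorem sub_op {S T : (E3 → C3) → E3 → G} (hS : IsSurfaceOperator Ω S)
    (hT : IsSurfaceOperator Ω T) : IsSurfaceOperator Ω fun V x => S V x - T V x := by
  simpa only [sub_eq_add_neg] using hS.add_op hT.neg_op

theorem zero : IsSurfaceOperator Ω fun _ _ => (0 : G) :=
  ⟨fun _ _ _ _ _ => rfl, by simp, by simp, fun _ _ => contDiffOn_const⟩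

theorem sum {ι : Type*} (s : Finset ι) {T : ι → (E3 → C3) → E3 → G}
    (hT : ∀ i, IsSurfaceOperator Ω (T i)) : IsSurfaceOperator Ω fun V x => ∑ i ∈ s, T i V x := by
  classical
  induction s using Finset.induction_on with
  | empty => simpa using zero
  | insert i s hi ih => simpa only [Finset.sum_insert hi] using (hT i).add_op ih

theorem pi {T : (E3 → C3) → E3 → C3} (hT : ∀ i, IsSurfaceOperator Ω fun V x => T V x i) :
    IsSurfaceOperator Ω T where
  congr V W h _ hx := funext fun i => (hT i).congr V W h hx
  add V W hV hW x hx := funext fun i => (hT i).add V W hV hW x hx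
  smul c V hV x hx := funext fun i => (hT i).smul c V hV x hx
  smooth V hV := contDiffOn_pi.2 fun i => (hT i).smooth V hV

theorem cross {T : (E3 → C3) → E3 → C3} (hT : IsSurfaceOperator Ω T) {w : E3 → C3}
    (hw : ContDiffOn ℝ ∞ w (frontier Ω)) : IsSurfaceOperator Ω fun V x => T V x ⨯₃ w x :=
  hT.map (fun x a => a ⨯₃ w x) (by simp) (by simp) fun _ h => contDiffOn_cross h hw

theorem dot {T : (E3 → C3) → E3 → C3} (hT : IsSurfaceOperator Ω T) {w : E3 → C3}
    (hw : ContDiffOn ℝ ∞ w (frontier Ω)) : IsSurfaceOperator Ω fun V x => T V x ⬝ᵥ w x :=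
  hT.map (fun x a => a ⬝ᵥ w x) (by simp) (by simp) fun _ h => contDiffOn_dot h hw

theorem smul_field {T : (E3 → C3) → E3 → ℂ} (hT : IsSurfaceOperator Ω T) {w : E3 → C3}
    (hw : ContDiffOn ℝ ∞ w (frontier Ω)) : IsSurfaceOperator Ω fun V x => T V x • w x :=
  hT.map (fun x a => a • w x) (by simp [add_smul]) (by simp [mul_smul]) fun _ h => h.smul hw

theorem matrix_act {T : (E3 → C3) → E3 → C3} (hT : IsSurfaceOperator Ω T)
    {A : E3 → Matrix (Fin 3) (Fin 3) ℝ}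
    (hA : ∀ i j, ContDiffOn ℝ ∞ (fun x => A x i j) (frontier Ω)) :
    IsSurfaceOperator Ω fun V x => act (A x) (T V x) :=
  hT.map (fun x a => act (A x) a) (by simp [act, Matrix.mulVec_add])
    (by simp [act, Matrix.mulVec_smul]) fun _ h => contDiffOn_act hA h

theorem apply {T : (E3 → C3) → E3 → C3} (hT : IsSurfaceOperator Ω T) (i : Fin 3) :
    IsSurfaceOperator Ω fun V x => T V x i :=
  hT.map (fun _ a => a i) (by simp) (by simp) fun _ h => contDiffOn_pi.1 h i

theorem surfGrad (hΩ : IsSmoothBoundedDomain Ω) {T : (E3 → C3) → E3 → ℂ}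
    (hT : IsSurfaceOperator Ω T) : IsSurfaceOperator Ω fun V x => surfGrad Ω (T V) x := by
  have hd : ∀ V, ContDiffOn ℝ ∞ V (frontier Ω) → DifferentiableOn ℝ (T V) (frontier Ω) :=
    fun V hV => (hT.smooth V hV).differentiableOn (by simp)
  refine pi fun j => ⟨?_, ?_, ?_, ?_⟩
  · exact fun V W h x hx => surfPartial_congr hx (hT.congr V W h) j
  · intro V W hV hW x hx
    exact (surfPartial_congr hx (hT.add V W hV hW) j).trans
      (hΩ.surfPartial_add hx (hd V hV x hx) (hd W hW x hx) j)
  · intro c V hV x hx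
    exact (surfPartial_congr hx (hT.smul c V hV) j).trans
      (hΩ.surfPartial_const_mul hx (hd V hV x hx) c j)
  · exact fun V hV => hΩ.contDiffOn_surfPartial (hT.smooth V hV) j

theorem opC (hΩ : IsSmoothBoundedDomain Ω) : IsSurfaceOperator Ω (opC Ω) := by
  have hn := hΩ.contDiffOn_nC
  refine ((smul_field ?_ hn).add_op ((surfGrad hΩ (id.dot hn)).cross hn)).sub_op
    ((id.matrix_act hΩ.contDiffOn_curvature).cross hn)
  exact sum Finset.univ fun i => (surfGrad hΩ ((id.cross hn).apply i)).apply i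

theorem opCM (hΩ : IsSmoothBoundedDomain Ω) : IsSurfaceOperator Ω (opCM Ω) := by
  have hn := hΩ.contDiffOn_nC
  refine ((smul_field ?_ hn).add_op
    (((surfGrad hΩ (id.dot hn)).matrix_act hΩ.contDiffOn_tensorM).cross hn)).sub_op
    ((id.matrix_act hΩ.contDiffOn_tensorG).cross hn)
  exact sum Finset.univ fun i =>
    ((surfGrad hΩ ((id.cross hn).apply i)).matrix_act hΩ.contDiffOn_tensorM).apply i

theorem map_zero {T : (E3 → C3) → E3 → G} (hT : IsSurfaceOperator Ω T) {x : E3}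
    (hx : x ∈ frontier Ω) : T (fun _ => 0) x = 0 := by
  simpa using hT.smul 0 (fun _ => 0) contDiffOn_const x hx

/-- With `η` fixed, the factors `e^{-√i η} η ^ j` are constants on the surface; this lets an
operator act on an exponential polynomial coefficient by coefficient. -/
theorem map_sum {T : (E3 → C3) → E3 → G} (hT : IsSurfaceOperator Ω T) {ι : Type*} (s : Finset ι)
    (c : ι → ℂ) (a : ι → E3 → C3) (ha : ∀ i, ContDiffOn ℝ ∞ (a i) (frontier Ω)) {x : E3}
    (hx : x ∈ frontier Ω) :
    T (fun y => ∑ i ∈ s, c i • a i y) x = ∑ i ∈ s, c i • T (a i) x := by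
  classical
  induction s using Finset.induction_on with
  | empty => simpa using hT.map_zero hx
  | insert i s hi ih =>
    simp only [Finset.sum_insert hi]
    rw [hT.add _ _ ((ha i).const_smul (c i)) (ContDiffOn.sum fun j _ => (ha j).const_smul (c j)) x hx,
      hT.smul _ _ (ha i) x hx, ih]

end IsSurfaceOperator

/-! ### Exponential polynomials in the normal variable -/

theorem sqrtI_sq : sqrtI ^ 2 = Complex.I := by
  have h2 : ((√2 : ℝ) : ℂ) ^ 2 = 2 := by
    rw [← Complex.ofReal_pow, Real.sq_sqrt (by norm_num)]
    norm_num
  have hI := Complex.I_sq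
  rw [sqrtI]
  push_cast
  linear_combination (1 / 4 + Complex.I / 2 + Complex.I ^ 2 / 4) * h2 + (1 / 2) * hI

theorem sqrtI_ne_zero : sqrtI ≠ 0 := by
  intro h
  have := sqrtI_sq
  simp [h] at this
  exact Complex.I_ne_zero this.symm

theorem sqrtI_re : sqrtI.re = √2 / 2 := by
  rw [sqrtI, Complex.re_ofReal_mul]
  simp

/-! ### Differential equations for coefficient sequences. -/

section Coefficients

variable {V : Type*} [AddCommGroup V] [Module ℂ V]

/-- The coefficients of the derivative of `e^{-√i η} ∑ η ^ j a_j`. -/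
noncomputable def coeffDeriv (a : ℕ → V) (j : ℕ) : V := ((j : ℂ) + 1) • a (j + 1) - sqrtI • a j

theorem coeffDeriv_mem {S : Submodule ℂ V} {a : ℕ → V} (ha : ∀ j, a j ∈ S) (j : ℕ) :
    coeffDeriv a j ∈ S :=
  S.sub_mem (S.smul_mem _ (ha _)) (S.smul_mem _ (ha _))

theorem coeffDeriv_eq_zero {a : ℕ → V} {d : ℕ} (ha : ∀ j, d ≤ j → a j = 0) (j : ℕ) (hj : d ≤ j) :
    coeffDeriv a j = 0 := by
  simp [coeffDeriv, ha j hj, ha (j + 1) (by lia)]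

/-- Solution of `q' - 2 c q = r` for polynomials. -/
theorem exists_coeff_firstOrder (S : Submodule ℂ V) {c : ℂ} (hc : c ≠ 0) (d : ℕ) (r : ℕ → V)
    (hr : ∀ j, r j ∈ S) (hd : ∀ j, d ≤ j → r j = 0) :
    ∃ q : ℕ → V, (∀ j, q j ∈ S) ∧ (∀ j, d ≤ j → q j = 0) ∧
      ∀ j : ℕ, ((j : ℂ) + 1) • q (j + 1) - c • q j = r j := by
  induction d generalizing r with
  | zero => exact ⟨fun _ => 0, fun _ => S.zero_mem, fun _ _ => rfl, fun j => by simp [hd j]⟩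
  | succ d ih =>
    -- Substituting `q = p - c⁻¹ r` turns the equation into `p' - c p = c⁻¹ r'`, whose right-hand
    -- side has one term fewer.
    obtain ⟨q, hq1, hq2, hq3⟩ := ih (fun j : ℕ => (c⁻¹ * ((j : ℂ) + 1)) • r (j + 1))
      (fun j => S.smul_mem _ (hr _)) (fun j hj => by simp [hd (j + 1) (by lia)])
    refine ⟨fun j => q j - c⁻¹ • r j, fun j => S.sub_mem (hq1 j) (S.smul_mem _ (hr j)),
      fun j hj => by simp [hd j hj, hq2 j (by lia)], fun j => ?_⟩
    have h1 : c • c⁻¹ • r j = r j := by rw [smul_smul, mul_inv_cancel₀ hc, one_smul]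
    rw [smul_sub, smul_sub, h1]
    have h2 := hq3 j
    rw [mul_comm, ← smul_smul] at h2
    rw [show ∀ a b e f : V, a - b - (e - f) = (a - e) - b + f by intros; abel, h2]
    abel

/-- Solution of `w'' - i w = r` for exponential polynomials, with prescribed initial value. -/
theorem exists_coeff_secondOrder (S : Submodule ℂ V) (d : ℕ) (r : ℕ → V)
    (hr : ∀ j, r j ∈ S) (hd : ∀ j, d ≤ j → r j = 0) (b : V) (hb : b ∈ S) :
    ∃ h : ℕ → V, (∀ j, h j ∈ S) ∧ (∀ j, d + 1 ≤ j → h j = 0) ∧ h 0 = b ∧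
      ∀ j, coeffDeriv (coeffDeriv h) j - Complex.I • h j = r j := by
  -- For `w = e^{-√i η} p` the equation reads `p'' - 2 √i p' = r`, of first order in `q = p'`.
  -- Integrating `q` adds one term, and the constant of integration is the initial value `b`.
  obtain ⟨q, hq1, hq2, hq3⟩ := exists_coeff_firstOrder S
    (mul_ne_zero (two_ne_zero' ℂ) sqrtI_ne_zero) d r hr hd
  refine ⟨fun j => Nat.casesOn j b fun i => ((i : ℂ) + 1)⁻¹ • q i, ?_, ?_, rfl, ?_⟩
  · rintro (_ | j)
    exacts [hb, S.smul_mem _ (hq1 j)]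
  · rintro (_ | j) hj
    · lia
    · simp [hq2 j (by lia)]
  · intro j
    set h : ℕ → V := fun j => Nat.casesOn j b fun i => ((i : ℂ) + 1)⁻¹ • q i with hh
    have key : ∀ i : ℕ, ((i : ℂ) + 1) • h (i + 1) = q i := fun i => by
      simp only [hh]
      rw [smul_smul, mul_inv_cancel₀ (Nat.cast_add_one_ne_zero i), one_smul]
    have hder : ∀ i, coeffDeriv h i = q i - sqrtI • h i := fun i => by rw [coeffDeriv, key]
    rw [coeffDeriv, hder, hder, smul_sub, smul_comm _ sqrtI, key, ← hq3 j, ← sqrtI_sq]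
    module

end Coefficients

/-! ### Exponential polynomial profiles and their closure properties. -/

/-- The profile `e^{-√i η} ∑_{j < d} η ^ j a_j(x)`. -/
noncomputable def expPoly (d : ℕ) (a : ℕ → E3 → C3) : Profile := fun x η =>
  Complex.exp (-(sqrtI * η)) • ∑ j ∈ Finset.range d, ((η : ℂ) ^ j) • a j x

theorem hasDerivAt_expPoly {d : ℕ} {a : ℕ → E3 → C3} (ha : ∀ j, d ≤ j → a j = 0) (x : E3) (η : ℝ) :
    HasDerivAt (expPoly d a x) (expPoly d (coeffDeriv a) x η) η := by
  have he : HasDerivAt (fun t : ℝ => Complex.exp (-(sqrtI * t)))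
      (Complex.exp (-(sqrtI * η)) * -sqrtI) η := by
    have h1 : HasDerivAt (fun t : ℝ => -(sqrtI * (t : ℂ))) (-sqrtI) η := by
      have h2 := ((Complex.ofRealCLM.hasDerivAt (x := η)).const_mul sqrtI).neg
      simp only [Complex.ofRealCLM_apply, Complex.ofReal_one, mul_one] at h2
      exact h2
    exact h1.cexp
  have hp : ∀ j : ℕ, HasDerivAt (fun t : ℝ => ((t : ℂ) ^ j) • a j x)
      (((j : ℂ) * (η : ℂ) ^ (j - 1)) • a j x) η := by
    intro j
    have h1 : HasDerivAt (fun t : ℝ => (t : ℂ) ^ j) ((j : ℂ) * (η : ℂ) ^ (j - 1)) η := by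
      simpa using (hasDerivAt_pow j (η : ℂ)).comp_ofReal
    exact h1.smul_const (a j x)
  have h := he.smul (HasDerivAt.fun_sum (u := Finset.range d) fun j _ => hp j)
  convert! h using 1
  -- Shifting the index would bring in `a d` at the top, which is zero; this is why derivatives have
  -- no more terms than the original.
  have hshift : ∑ j ∈ Finset.range d, ((j : ℂ) * (η : ℂ) ^ (j - 1)) • a j x
      = ∑ j ∈ Finset.range d, (((j : ℂ) + 1) * (η : ℂ) ^ j) • a (j + 1) x := by
    have h1 := Finset.sum_range_succ (fun j : ℕ => ((j : ℂ) * (η : ℂ) ^ (j - 1)) • a j x) d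
    rw [Finset.sum_range_succ'] at h1
    simpa [ha d le_rfl] using h1.symm
  rw [hshift, mul_smul, ← smul_add, expPoly]
  congr 1
  rw [Finset.smul_sum, ← Finset.sum_add_distrib]
  refine Finset.sum_congr rfl fun j _ => ?_
  simp only [coeffDeriv, Pi.sub_apply, Pi.smul_apply]
  match_scalars <;> ring

theorem expPoly_eq_of_le {d e : ℕ} (hde : d ≤ e) {a : ℕ → E3 → C3} (ha : ∀ j, d ≤ j → a j = 0) :
    expPoly e a = expPoly d a := by
  funext x η
  rw [expPoly, expPoly]
  congr 1
  refine (Finset.sum_subset (Finset.range_mono hde) fun j _ hj => ?_).symm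
  rw [ha j (by simpa using hj)]
  simp

theorem expPoly_congr {d : ℕ} {a b : ℕ → E3 → C3} {x : E3} (h : ∀ j < d, a j x = b j x) (η : ℝ) :
    expPoly d a x η = expPoly d b x η := by
  rw [expPoly, expPoly]
  congr 1
  exact Finset.sum_congr rfl fun j hj => by rw [h j (Finset.mem_range.1 hj)]

theorem dEta_eq_of_hasDerivAt {u v : Profile} {x : E3} {η : ℝ} {w : C3}
    (huv : ∀ t : ℝ, 0 ≤ t → u x t = v x t) (hη : 0 ≤ η) (hv : HasDerivAt (v x) w η) :
    dEta u x η = w := by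
  rw [dEta, derivWithin_congr (s := Set.Ici 0) (fun t ht => huv t ht) (huv η hη)]
  exact hv.hasDerivWithinAt.derivWithin (uniqueDiffOn_Ici 0 η hη)

theorem dEta_expPoly {d : ℕ} {a : ℕ → E3 → C3} (ha : ∀ j, d ≤ j → a j = 0) (x : E3) {η : ℝ}
    (hη : 0 ≤ η) : dEta (expPoly d a) x η = expPoly d (coeffDeriv a) x η :=
  dEta_eq_of_hasDerivAt (fun _ _ => rfl) hη (hasDerivAt_expPoly ha x η)

/-- On `Γ × [0, ∞)`, `u` is the product of `e^{-√i η}` and a polynomial in `η` with at most `d`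
terms whose coefficients are smooth on `Γ`. -/
def IsExpPoly (Ω : Set E3) (d : ℕ) (u : Profile) : Prop :=
  ∃ a : ℕ → E3 → C3, (∀ j, ContDiffOn ℝ ∞ (a j) (frontier Ω)) ∧ (∀ j, d ≤ j → a j = 0) ∧
    ∀ x ∈ frontier Ω, ∀ η : ℝ, 0 ≤ η → u x η = expPoly d a x η

namespace IsExpPoly

variable {Ω : Set E3} {d e : ℕ} {u v : Profile}

/-- Coefficients produced by surface operators are controlled only on the boundary, whereas
`IsExpPoly` wants those beyond `d` to vanish identically. Truncating them changes nothing in the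
sum. -/
theorem of_coeff {a : ℕ → E3 → C3} (ha : ∀ j, ContDiffOn ℝ ∞ (a j) (frontier Ω))
    (hu : ∀ x ∈ frontier Ω, ∀ η : ℝ, 0 ≤ η → u x η = expPoly d a x η) : IsExpPoly Ω d u := by
  refine ⟨fun j => if j < d then a j else 0, fun j => ?_, fun j hj => ?_, fun x hx η hη => ?_⟩
  · by_cases hj : j < d
    · simpa [hj] using ha j
    · simp only [hj, if_false]
      exact contDiffOn_const
  · simp [hj]
  · rw [hu x hx η hη]
    exact expPoly_congr (fun j hj => by simp [hj]) η

theorem congr (hu : IsExpPoly Ω d u) (h : ∀ x ∈ frontier Ω, ∀ η : ℝ, 0 ≤ η → v x η = u x η) :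
    IsExpPoly Ω d v := by
  obtain ⟨a, ha, hd, hua⟩ := hu
  exact ⟨a, ha, hd, fun x hx η hη => (h x hx η hη).trans (hua x hx η hη)⟩

theorem mono (hu : IsExpPoly Ω d u) (hde : d ≤ e) : IsExpPoly Ω e u := by
  obtain ⟨a, ha, hd, hua⟩ := hu
  exact ⟨a, ha, fun j hj => hd j (hde.trans hj), by rwa [expPoly_eq_of_le hde hd]⟩

theorem zero : IsExpPoly Ω d fun _ _ => 0 :=
  ⟨fun _ _ => 0, fun _ => contDiffOn_const, fun _ _ => rfl, fun x _ η _ => by simp [expPoly]⟩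

theorem add (hu : IsExpPoly Ω d u) (hv : IsExpPoly Ω d v) :
    IsExpPoly Ω d fun x η => u x η + v x η := by
  obtain ⟨a, ha, hd, hua⟩ := hu
  obtain ⟨b, hb, hd', hvb⟩ := hv
  refine ⟨fun j x => a j x + b j x, fun j => (ha j).add (hb j), fun j hj => ?_,
    fun x hx η hη => ?_⟩
  · funext x
    simp [hd j hj, hd' j hj]
  · change u x η + v x η = _
    rw [hua x hx η hη, hvb x hx η hη]
    simp only [expPoly, smul_add, Finset.sum_add_distrib]

theorem sum {ι : Type*} (s : Finset ι) {F : ι → Profile} (hF : ∀ i ∈ s, IsExpPoly Ω d (F i)) :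
    IsExpPoly Ω d fun x η => ∑ i ∈ s, F i x η := by
  classical
  induction s using Finset.induction_on with
  | empty => simpa using zero
  | insert i s hi ih =>
    simp only [Finset.sum_insert hi]
    exact (hF i (by simp)).add (ih fun j hj => hF j (by simp [hj]))

/-- A surface operator acts on the coefficients. -/
theorem map {T : (E3 → C3) → E3 → C3} (hT : IsSurfaceOperator Ω T) (hu : IsExpPoly Ω d u) :
    IsExpPoly Ω d fun x η => T (fun y => u y η) x := by
  obtain ⟨a, ha, hd, hua⟩ := hu
  refine of_coeff (a := fun j => T (a j)) (fun j => hT.smooth _ (ha j)) fun x hx η hη => ?_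
  rw [hT.congr _ _ (fun y hy => hua y hy η hη) hx]
  simp only [expPoly, Finset.smul_sum, smul_smul]
  exact hT.map_sum _ _ a ha hx

theorem neg (hu : IsExpPoly Ω d u) : IsExpPoly Ω d fun x η => -u x η :=
  hu.map IsSurfaceOperator.id.neg_op

theorem sub (hu : IsExpPoly Ω d u) (hv : IsExpPoly Ω d v) :
    IsExpPoly Ω d fun x η => u x η - v x η := by
  simpa only [sub_eq_add_neg] using hu.add hv.neg

theorem smul (hu : IsExpPoly Ω d u) {f : E3 → ℂ} (hf : ContDiffOn ℝ ∞ f (frontier Ω)) :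
    IsExpPoly Ω d fun x η => f x • u x η :=
  hu.map (T := fun V x => f x • V x) (IsSurfaceOperator.id.map (fun x a => f x • a) (by simp)
    (fun x c a => smul_comm _ _ _) fun _ h => hf.smul h)

theorem eta_smul (hu : IsExpPoly Ω d u) : IsExpPoly Ω (d + 1) fun x η => (η : ℂ) • u x η := by
  obtain ⟨a, ha, hd, hua⟩ := hu
  refine ⟨fun j => Nat.casesOn j 0 a, ?_, ?_, fun x hx η hη => ?_⟩
  · rintro (_ | j)
    exacts [contDiffOn_const, ha j]
  · rintro (_ | j) hj
    exacts [rfl, hd j (by lia)]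
  · change (η : ℂ) • u x η = _
    rw [hua x hx η hη]
    simp only [expPoly, Finset.sum_range_succ']
    change _ = Complex.exp (-(sqrtI * η)) • (_ + (η : ℂ) ^ 0 • (0 : C3))
    rw [smul_zero, add_zero, smul_comm, Finset.smul_sum]
    simp only [smul_smul, pow_succ']

theorem isSmoothProfile (hu : IsExpPoly Ω d u) : IsSmoothProfile Ω u := by
  obtain ⟨a, ha, hd, hua⟩ := hu
  have h2 : ContDiffOn ℝ ∞ (fun p : E3 × ℝ => (p.2 : ℂ)) (frontier Ω ×ˢ Set.Ici (0 : ℝ)) :=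
    contDiffOn_ofReal contDiff_snd.contDiffOn
  have h : ContDiffOn ℝ ∞ (fun p : E3 × ℝ => expPoly d a p.1 p.2)
      (frontier Ω ×ˢ Set.Ici (0 : ℝ)) := by
    refine ContDiffOn.smul (contDiffOn_const.mul h2).neg.cexp (ContDiffOn.sum fun j _ => ?_)
    exact (h2.pow j).smul ((ha j).comp contDiff_fst.contDiffOn fun p hp => hp.1)
  exact h.congr fun p hp => hua p.1 hp.1 p.2 hp.2

theorem isPolyProfile (hu : IsExpPoly Ω (d + 1) u) :
    IsPolyProfile Ω d fun x η => Complex.exp (sqrtI * η) • u x η := by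
  obtain ⟨a, ha, -, hua⟩ := hu
  refine ⟨a, ha, fun x hx η hη => ?_⟩
  change Complex.exp (sqrtI * η) • u x η = _
  rw [hua x hx η hη, expPoly, smul_smul, ← Complex.exp_add]
  simp

theorem integrableOn (hu : IsExpPoly Ω d u) {x : E3} (hx : x ∈ frontier Ω) :
    MeasureTheory.IntegrableOn (fun η : ℝ => ∑ j, ‖u x η j‖ ^ 2) (Set.Ioi 0) := by
  obtain ⟨a, ha, -, hua⟩ := hu
  have hcont : Continuous (expPoly d a x) := by
    unfold expPoly
    fun_prop
  -- The exponential decays at rate `√2 / 2`. Half of this rate absorbs the polynomial, and squaring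
  -- the rest restores `√2 / 2`.
  have hpos : 0 < √2 / 4 := by positivity
  have hO : expPoly d a x =O[atTop] fun η : ℝ => Real.exp (-(√2 / 4) * η) := by
    have h1 : (fun η : ℝ => Complex.exp (-(sqrtI * η))) =O[atTop]
        fun η : ℝ => Real.exp (-(√2 / 2) * η) := by
      refine Asymptotics.IsBigO.of_bound 1 (Eventually.of_forall fun η => ?_)
      rw [Complex.norm_exp, Real.norm_of_nonneg (Real.exp_pos _).le, one_mul]
      simp [sqrtI_re]
    have h2 : (fun η : ℝ => ∑ j ∈ Finset.range d, ((η : ℂ) ^ j) • a j x) =O[atTop]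
        fun η : ℝ => Real.exp (√2 / 4 * η) := by
      refine Asymptotics.IsBigO.fun_sum fun j _ => ?_
      have h3 : (fun η : ℝ => η ^ j) =O[atTop] fun η : ℝ => Real.exp (√2 / 4 * η) :=
        (isLittleO_pow_exp_pos_mul_atTop j hpos).isBigO
      refine Asymptotics.IsBigO.trans (Asymptotics.IsBigO.of_bound ‖a j x‖
        (Eventually.of_forall fun η => ?_)) h3
      rw [norm_smul, norm_pow, norm_pow, Complex.norm_real, mul_comm]
    refine (h1.smul h2).congr_right fun η => ?_
    rw [smul_eq_mul, ← Real.exp_add]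
    congr 1
    ring
  have h : MeasureTheory.IntegrableOn (fun η : ℝ => ∑ j, ‖expPoly d a x η j‖ ^ 2)
      (Set.Ioi 0) := by
    refine integrable_of_isBigO_exp_neg (b := √2 / 2) (by positivity)
      (by fun_prop) (Asymptotics.IsBigO.fun_sum fun j _ => ?_)
    have hj : (fun η : ℝ => ‖expPoly d a x η j‖) =O[atTop]
        fun η : ℝ => Real.exp (-(√2 / 4) * η) :=
      (Asymptotics.IsBigO.of_bound 1 (Eventually.of_forall fun η => by
        simpa using norm_le_pi_norm (expPoly d a x η) j)).trans hO
    refine (hj.pow 2).congr_right fun η => ?_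
    rw [← Real.exp_nat_mul]
    congr 1
    push_cast
    ring
  refine h.congr_fun (fun η hη => ?_) measurableSet_Ioi
  simp only [hua x hx η (le_of_lt hη)]

end IsExpPoly

/-! ### Solution of one step of the recursion -/

theorem IsSmoothBoundedDomain.nC_dot_self {Ω : Set E3} (hΩ : IsSmoothBoundedDomain Ω) {x : E3}
    (hx : x ∈ frontier Ω) : nC Ω x ⬝ᵥ nC Ω x = 1 := by
  have h := EuclideanSpace.real_norm_sq_eq (normal Ω x)
  rw [hΩ.norm_normal hx] at h
  simp only [dotProduct, nC]
  rw [← Complex.ofReal_one, ← one_pow 2, h]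
  push_cast
  exact Finset.sum_congr rfl fun i _ => (sq _).symm

/-- Up to sign, crossing twice with `n` is the tangential projection. The product `⬝ᵥ` is bilinear,
without conjugation, which suits the normal because its components are real. -/
theorem cross_cross_unit {n : C3} (hn : n ⬝ᵥ n = 1) (u : C3) :
    (u ⨯₃ n) ⨯₃ n = (u ⬝ᵥ n) • n - u := by
  simp only [dotProduct, Fin.sum_univ_three] at hn
  ext i
  fin_cases i <;> simp [cross_apply, dotProduct, Fin.sum_univ_three]
  · linear_combination (-u 0) * hn
  · linear_combination (-u 1) * hn
  · linear_combination (-u 2) * hn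

theorem cross_dot_self_right (u n : C3) : (u ⨯₃ n) ⬝ᵥ n = 0 := by
  rw [dotProduct_comm, dot_cross_self]

theorem expPoly_cross_add_smul {d : ℕ} (a e : ℕ → E3 → C3) (x : E3) (η : ℝ) (n : C3) (c : ℂ) :
    expPoly d a x η ⨯₃ n + c • expPoly d e x η
      = Complex.exp (-(sqrtI * η)) •
          ∑ j ∈ Finset.range d, ((η : ℂ) ^ j) • (a j x ⨯₃ n + c • e j x) := by
  simp only [expPoly, map_smul, LinearMap.smul_apply, map_sum, LinearMap.sum_apply, smul_add,
    Finset.sum_add_distrib, Finset.smul_sum]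
  congr 1
  exact Finset.sum_congr rfl fun j _ => by simp only [smul_smul]; congr 1; ring

/-- The smooth tangential fields. -/
def tangentialFields (Ω : Set E3) : Submodule ℂ (E3 → C3) where
  carrier := {V | ContDiffOn ℝ ∞ V (frontier Ω) ∧ ∀ x ∈ frontier Ω, V x ⬝ᵥ nC Ω x = 0}
  add_mem' := fun hV hW => ⟨hV.1.add hW.1, fun x hx => by simp [hV.2 x hx, hW.2 x hx]⟩
  zero_mem' := ⟨contDiffOn_const, by simp⟩
  smul_mem' := fun c V hV => ⟨hV.1.const_smul c, fun x hx => by simp [hV.2 x hx]⟩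

/-- The smooth fields. -/
def smoothFields (Ω : Set E3) : Submodule ℂ (E3 → C3) where
  carrier := {V | ContDiffOn ℝ ∞ V (frontier Ω)}
  add_mem' := fun hV hW => ContDiffOn.add hV hW
  zero_mem' := contDiffOn_const
  smul_mem' := fun c _ hV => ContDiffOn.const_smul c hV

/-- The algebraic system for the coefficients. -/
theorem IsSmoothBoundedDomain.exists_coeff {Ω : Set E3} (hΩ : IsSmoothBoundedDomain Ω) {om : ℝ}
    (hom : om ≠ 0) (d : ℕ) (f g : ℕ → E3 → C3) (hf : ∀ j, ContDiffOn ℝ ∞ (f j) (frontier Ω))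
    (hg : ∀ j, ContDiffOn ℝ ∞ (g j) (frontier Ω)) (hfd : ∀ j, d ≤ j → f j = 0)
    (hgd : ∀ j, d ≤ j → g j = 0) (b : E3 → C3)
    (hb : ContDiffOn ℝ ∞ (fun x => b x ⨯₃ nC Ω x) (frontier Ω)) :
    ∃ e H : ℕ → E3 → C3, (∀ j, ContDiffOn ℝ ∞ (e j) (frontier Ω)) ∧
      (∀ j, ContDiffOn ℝ ∞ (H j) (frontier Ω)) ∧ (∀ j, d + 1 ≤ j → e j = 0) ∧
      (∀ j, d + 1 ≤ j → H j = 0) ∧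
      (∀ x ∈ frontier Ω, ∀ j,
        coeffDeriv H j x ⨯₃ nC Ω x + ((1 : ℂ) / om) • e j x = f j x) ∧
      (∀ x ∈ frontier Ω, ∀ j,
        coeffDeriv e j x ⨯₃ nC Ω x + (-(Complex.I * om)) • H j x = -g j x) ∧
      ∀ x ∈ frontier Ω, H 0 x ⨯₃ nC Ω x = b x ⨯₃ nC Ω x := by
  have hn := hΩ.contDiffOn_nC
  have hom' : (om : ℂ) ≠ 0 := by exact_mod_cast hom
  have hfS : ∀ j, f j ∈ smoothFields Ω := hf
  -- Inserting `e = ω (f - H' × n)` into the second equation and keeping tangential parts gives `h''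
  -- - i h = -f' × n + ω⁻¹ (g × n) × n`. Solving inside `tangentialFields` keeps the coefficients
  -- smooth and tangential. The initial value is the tangential part of `b`, written through `b ×
  -- n`, whose smoothness is given.
  obtain ⟨h, hh, hhd, hh0, hrec⟩ := exists_coeff_secondOrder (tangentialFields Ω) d
    (fun j x => (-(coeffDeriv f j x) + ((om : ℂ)⁻¹) • (g j x ⨯₃ nC Ω x)) ⨯₃ nC Ω x)
    (fun j => ⟨contDiffOn_cross (((coeffDeriv_mem hfS j : ContDiffOn ℝ ∞ _ _).neg).add
        ((contDiffOn_cross (hg j) hn).const_smul _)) hn,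
      fun x hx => cross_dot_self_right _ _⟩)
    (fun j hj => by
      funext x
      simp [hgd j hj, coeffDeriv_eq_zero hfd j hj])
    (fun x => -((b x ⨯₃ nC Ω x) ⨯₃ nC Ω x))
    ⟨(contDiffOn_cross hb hn).neg, fun x hx => by
      rw [neg_dotProduct, cross_dot_self_right, neg_zero]⟩
  -- The normal part of `H` is read off from the normal part of the second equation; `e` is then
  -- defined by the first equation.
  set H : ℕ → E3 → C3 :=
    fun j x => h j x + ((Complex.I * om)⁻¹ * (g j x ⬝ᵥ nC Ω x)) • nC Ω x with hH
  set e : ℕ → E3 → C3 :=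
    fun j x => (om : ℂ) • (f j x - coeffDeriv h j x ⨯₃ nC Ω x) with he
  have hHcross : ∀ j x, H j x ⨯₃ nC Ω x = h j x ⨯₃ nC Ω x := by
    intro j x
    simp [hH]
  have hHd : ∀ j x, coeffDeriv H j x ⨯₃ nC Ω x = coeffDeriv h j x ⨯₃ nC Ω x := by
    intro j x
    simp only [coeffDeriv, Pi.sub_apply, Pi.smul_apply, map_sub, map_smul, LinearMap.sub_apply,
      LinearMap.smul_apply, hHcross]
  have hHz : ∀ j, d + 1 ≤ j → H j = 0 := fun j hj => by
    funext x
    simp [hH, hhd j hj, hgd j (by lia)]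
  have hez : ∀ j, d + 1 ≤ j → e j = 0 := fun j hj => by
    funext x
    simp [he, hfd j (by lia), coeffDeriv_eq_zero hhd j hj]
  refine ⟨e, H, fun j => ?_, fun j => ?_, hez, hHz, fun x hx j => ?_, fun x hx j => ?_,
    fun x hx => ?_⟩
  · exact ((hf j).sub (contDiffOn_cross (coeffDeriv_mem hh j).1 hn)).const_smul _
  · exact (hh j).1.add ((contDiffOn_const.mul (contDiffOn_dot (hg j) hn)).smul hn)
  · rw [hHd]
    simp only [he, smul_smul]
    rw [one_div, inv_mul_cancel₀ hom', one_smul]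
    abel
  · have hnn := hΩ.nC_dot_self hx
    have h1 : coeffDeriv e j x
        = (om : ℂ) • (coeffDeriv f j x - coeffDeriv (coeffDeriv h) j x ⨯₃ nC Ω x) := by
      simp only [he, coeffDeriv, Pi.sub_apply, Pi.smul_apply, map_sub, map_smul,
        LinearMap.sub_apply, LinearMap.smul_apply]
      module
    have h2 := congrFun (hrec j) x
    simp only [Pi.sub_apply, Pi.smul_apply, map_add, map_neg, map_smul, LinearMap.add_apply,
      LinearMap.neg_apply, LinearMap.smul_apply, cross_cross_unit hnn] at h2
    -- Tangential fields are stable under `coeffDeriv`, so crossing `h''` twice with `n` just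
    -- changes its sign.
    have h3 : coeffDeriv (coeffDeriv h) j x ⬝ᵥ nC Ω x = 0 :=
      (coeffDeriv_mem (fun i => coeffDeriv_mem hh i) j).2 x hx
    rw [h1, map_smul, LinearMap.smul_apply, map_sub, LinearMap.sub_apply, cross_cross_unit hnn,
      h3, sub_eq_iff_eq_add.1 h2]
    simp only [hH]
    have hI : Complex.I ≠ 0 := Complex.I_ne_zero
    match_scalars <;> field_simp <;> ring
  · have hnn := hΩ.nC_dot_self hx
    rw [hHcross, hh0, map_neg, LinearMap.neg_apply, cross_cross_unit hnn, cross_dot_self_right]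
    simp

theorem IsSmoothBoundedDomain.exists_step {Ω : Set E3} (hΩ : IsSmoothBoundedDomain Ω) {om : ℝ}
    (hom : om ≠ 0) {d : ℕ} {F G : Profile} (hF : IsExpPoly Ω d F) (hG : IsExpPoly Ω d G)
    (b : E3 → C3) (hb : ContDiffOn ℝ ∞ (fun x => b x ⨯₃ nC Ω x) (frontier Ω)) :
    ∃ E H : Profile, IsExpPoly Ω (d + 1) E ∧ IsExpPoly Ω (d + 1) H ∧
      (∀ x ∈ frontier Ω, ∀ η : ℝ, 0 ≤ η → lhsH Ω om E H x η = F x η) ∧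
      (∀ x ∈ frontier Ω, ∀ η : ℝ, 0 ≤ η → lhsE Ω om E H x η = G x η) ∧
      ∀ x ∈ frontier Ω, H x 0 ⨯₃ nC Ω x = b x ⨯₃ nC Ω x := by
  obtain ⟨f, hf, hfd, hFf⟩ := hF
  obtain ⟨g, hg, hgd, hGg⟩ := hG
  obtain ⟨e, h, he, hh, hed, hhd, h1, h2, h3⟩ := hΩ.exists_coeff hom d f g hf hg hfd hgd b hb
  refine ⟨expPoly (d + 1) e, expPoly (d + 1) h, ⟨e, he, hed, fun _ _ _ _ => rfl⟩,
    ⟨h, hh, hhd, fun _ _ _ _ => rfl⟩, fun x hx η hη => ?_, fun x hx η hη => ?_, fun x hx => ?_⟩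
  · rw [lhsH, dEta_expPoly hhd x hη, expPoly_cross_add_smul, hFf x hx η hη,
      ← expPoly_eq_of_le d.le_succ hfd]
    simp only [h1 x hx]
    rfl
  · have h4 := expPoly_cross_add_smul (d := d + 1) (coeffDeriv e) h x η (nC Ω x)
      (-(Complex.I * om))
    simp only [h2 x hx] at h4
    rw [lhsE, dEta_expPoly hed x hη, hGg x hx η hη, ← expPoly_eq_of_le d.le_succ hgd]
    rw [eq_comm, ← neg_inj, neg_add, neg_neg, ← neg_smul, h4, expPoly]
    simp
  · rw [← h3 x hx]
    congr 2
    simp [expPoly, Finset.sum_range_succ']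

/-- The operators of the right hand side raise the degree by their index, as the parts
`∂_η v × n + u / ω` and `-∂_η u × n + i ω v` have one term less than `u` and `v`. -/
theorem IsSmoothBoundedDomain.isExpPoly_opAH {Ω : Set E3} (hΩ : IsSmoothBoundedDomain Ω)
    (om εr : ℝ) {m : ℕ} {u v : Profile} (hu : IsExpPoly Ω (m + 1) u) (hv : IsExpPoly Ω (m + 1) v)
    (hL : IsExpPoly Ω m (lhsH Ω om u v)) {l : ℕ} (hl : l ∈ Finset.Icc 1 4) :
    IsExpPoly Ω (m + l) (opAH Ω om εr l u v) := by
  have hm := contDiffOn_ofReal hΩ.contDiffOn_meanCurv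
  have hgc := contDiffOn_ofReal hΩ.contDiffOn_gaussCurv
  rw [Finset.mem_Icc] at hl
  obtain ⟨hl1, hl2⟩ := hl
  -- Number of terms in each case: `l = 1` gives `m + 1` twice; `l = 2` gives `m + 1`, `m + 2` and
  -- `m + 2`; `l = 3` gives `m + 2`; `l = 4` gives `m + 3`. The bound `m + l` covers them all.
  interval_cases l
  · refine ((hv.map (IsSurfaceOperator.opC hΩ)).sub
      (hL.smul (contDiffOn_const (c := (2 : ℂ)) |>.mul hm)).eta_smul).congr fun x hx η hη => ?_
    simp only [opAH, smul_smul]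
    congr 2
    ring
  · refine (((hu.smul (contDiffOn_const (c := Complex.I * εr * om))).neg.mono (by lia)).add
      (hv.map (IsSurfaceOperator.opCM hΩ)).eta_smul |>.sub
      (hL.smul hgc).eta_smul.eta_smul).congr fun x hx η hη => ?_
    simp only [opAH, smul_smul]
    congr 2
    ring
  · refine ((hu.smul (contDiffOn_const (c := Complex.I * εr * om) |>.mul
      (contDiffOn_const (c := (2 : ℂ)) |>.mul hm))).eta_smul.neg.mono (by lia)).congr
      fun x hx η hη => ?_
    simp only [opAH, smul_smul]
    congr 2
    ring
  · refine ((hu.smul (contDiffOn_const (c := Complex.I * εr * om) |>.mul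
      hgc)).eta_smul.eta_smul.neg.mono (by lia)).congr fun x hx η hη => ?_
    simp only [opAH, smul_smul]
    congr 2
    ring

theorem IsSmoothBoundedDomain.isExpPoly_opAE {Ω : Set E3} (hΩ : IsSmoothBoundedDomain Ω)
    (om : ℝ) {m : ℕ} {u v : Profile} (hu : IsExpPoly Ω (m + 1) u)
    (hL : IsExpPoly Ω m (lhsE Ω om u v)) {l : ℕ} (hl : l ∈ Finset.Icc 1 2) :
    IsExpPoly Ω (m + l) (opAE Ω om l u v) := by
  have hm := contDiffOn_ofReal hΩ.contDiffOn_meanCurv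
  have hgc := contDiffOn_ofReal hΩ.contDiffOn_gaussCurv
  have hL' := hL.neg
  have heq : ∀ x η, -lhsE Ω om u v x η = dEta u x η ⨯₃ nC Ω x - (Complex.I * om) • v x η := by
    intro x η
    rw [lhsE]
    abel
  simp only [heq] at hL'
  rw [Finset.mem_Icc] at hl
  obtain ⟨hl1, hl2⟩ := hl
  interval_cases l
  · refine ((hu.map (IsSurfaceOperator.opC hΩ)).neg.add
      (hL'.smul (contDiffOn_const (c := (2 : ℂ)) |>.mul hm)).eta_smul).congr fun x hx η hη => ?_
    simp only [opAE, smul_smul]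
    congr 2
    ring
  · refine ((hu.map (IsSurfaceOperator.opCM hΩ)).eta_smul.neg.add
      (hL'.smul hgc).eta_smul.eta_smul).congr fun x hx η hη => ?_
    simp only [opAE, smul_smul]
    congr 2
    ring

/-! ### Uniqueness -/

/-- The square integrable solutions of `w' = z / ω`, `z' = i ω w` with `w(0) = 0` vanish, as `|w|²`
is nondecreasing. -/
theorem eq_zero_of_squareIntegrable {om : ℝ} (hom : 0 < om) {w z : ℝ → ℂ}
    (hw : ∀ t : ℝ, 0 ≤ t → HasDerivWithinAt w ((1 / om : ℂ) * z t) (Set.Ici 0) t)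
    (hz : ∀ t : ℝ, 0 ≤ t → HasDerivWithinAt z (Complex.I * om * w t) (Set.Ici 0) t)
    (h0 : w 0 = 0) {B : ℝ → ℝ} (hB : MeasureTheory.IntegrableOn B (Set.Ioi 0))
    (hwB : ∀ t : ℝ, 0 < t → ‖w t‖ ^ 2 ≤ B t) {t : ℝ} (ht : 0 ≤ t) : w t = 0 := by
  have mono : ∀ f f' : ℝ → ℝ, (∀ t : ℝ, 0 ≤ t → HasDerivWithinAt f (f' t) (Set.Ici 0) t) →
      (∀ t : ℝ, 0 ≤ t → 0 ≤ f' t) → MonotoneOn f (Set.Ici 0) := by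
    intro f f' hf hf'
    refine monotoneOn_of_hasDerivWithinAt_nonneg (f' := f') (convex_Ici 0)
      (fun t ht => (hf t ht).continuousWithinAt) (fun t ht => ?_) (fun t ht => ?_)
    · exact (hf t (interior_subset ht)).mono interior_subset
    · exact hf' t (interior_subset ht)
  -- The derivative of `Re (w̄ z)` is `‖z‖² / ω`, because the contribution `i ω |w|²` is purely
  -- imaginary.
  have hQ : ∀ t : ℝ, 0 ≤ t → 0 ≤ (inner ℝ (w t) (z t) : ℝ) := by
    intro t ht
    have h1 := mono (fun t => inner ℝ (w t) (z t)) (fun t => (1 / om) * ‖z t‖ ^ 2)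
      (fun t ht => by
        convert! (hw t ht).inner ℝ (hz t ht) using 1
        rw [← Complex.normSq_eq_norm_sq, Complex.normSq_apply, Complex.inner, Complex.inner,
          ← Complex.ofReal_one, ← Complex.ofReal_div]
        simp
        ring) (fun t ht => by positivity)
    simpa [h0] using h1 (Set.self_mem_Ici) ht ht
  have hN := mono (fun t => ‖w t‖ ^ 2) (fun t => 2 * inner ℝ (w t) ((1 / om : ℂ) * z t))
    (fun t ht => (hw t ht).norm_sq) (fun t ht => by
      have h1 : ((1 / om : ℂ) * z t) = (1 / om : ℝ) • z t := by
        rw [Complex.real_smul]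
        push_cast
        rfl
      rw [h1, inner_smul_right]
      have := hQ t ht
      positivity)
  -- A nonzero value at `t` would bound `B` below by a positive constant on a half-line of infinite
  -- measure.
  by_contra hne
  have hc : 0 < ‖w t‖ ^ 2 := by positivity
  have hint : MeasureTheory.IntegrableOn (fun _ : ℝ => ‖w t‖ ^ 2) (Set.Ioi t) := by
    refine MeasureTheory.Integrable.mono' (hB.mono_set (Set.Ioi_subset_Ioi ht))
      MeasureTheory.aestronglyMeasurable_const ?_
    refine (MeasureTheory.ae_restrict_iff' measurableSet_Ioi).2 (Eventually.of_forall fun s hs => ?_)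
    have hs : t < s := hs
    rw [Real.norm_of_nonneg hc.le]
    exact (hN ht (ht.trans hs.le) hs.le).trans (hwB s (ht.trans_lt hs))
  rw [MeasureTheory.integrableOn_const_iff] at hint
  rcases hint with h | h
  · simp at h
    exact hne h
  · simp at h

theorem IsSmoothProfile.hasDerivWithinAt {Ω : Set E3} {u : Profile} (hu : IsSmoothProfile Ω u)
    {x : E3} (hx : x ∈ frontier Ω) {η : ℝ} (hη : 0 ≤ η) :
    HasDerivWithinAt (u x) (dEta u x η) (Set.Ici 0) η := by
  have h1 : ContDiffOn ℝ ∞ (fun t : ℝ => u x t) (Set.Ici 0) :=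
    hu.comp (contDiff_const.prodMk contDiff_id).contDiffOn fun t ht => ⟨hx, ht⟩
  exact (h1.differentiableOn (by simp) η hη).hasDerivWithinAt

/-- The homogeneous problem at a boundary point has only the trivial solution. -/
theorem homogeneous_unique {om : ℝ} (hom : 0 < om) {n : C3} (hn : n ⬝ᵥ n = 1)
    {u v u' v' : ℝ → C3}
    (hu : ∀ t : ℝ, 0 ≤ t → HasDerivWithinAt u (u' t) (Set.Ici 0) t)
    (hv : ∀ t : ℝ, 0 ≤ t → HasDerivWithinAt v (v' t) (Set.Ici 0) t)
    (h1 : ∀ t : ℝ, 0 ≤ t → v' t ⨯₃ n + ((1 : ℂ) / om) • u t = 0)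
    (h2 : ∀ t : ℝ, 0 ≤ t → -(u' t ⨯₃ n) + (Complex.I * om) • v t = 0)
    (h0 : v 0 ⨯₃ n = 0) {B : ℝ → ℝ} (hB : MeasureTheory.IntegrableOn B (Set.Ioi 0))
    (hvB : ∀ t : ℝ, 0 < t → ∑ j, ‖v t j‖ ^ 2 ≤ B t) {t : ℝ} (ht : 0 ≤ t) :
    u t = 0 ∧ v t = 0 := by
  have hom' : (om : ℂ) ≠ 0 := by exact_mod_cast hom.ne'
  have hcd : ∀ (f : ℝ → C3) (f' : C3) (t : ℝ), HasDerivWithinAt f f' (Set.Ici 0) t →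
      HasDerivWithinAt (fun t => f t ⨯₃ n) (f' ⨯₃ n) (Set.Ici 0) t := by
    intro f f' t hf
    rw [hasDerivWithinAt_pi] at hf ⊢
    intro i
    fin_cases i <;> simp only [cross_apply] <;>
      exact ((hf _).mul_const _).sub ((hf _).mul_const _)
  -- Dotting each equation with `n` removes the cross product, so both fields are tangential.
  have hun : ∀ t : ℝ, 0 ≤ t → u t ⬝ᵥ n = 0 := by
    intro t ht
    have := congrArg (· ⬝ᵥ n) (h1 t ht)
    simpa [cross_dot_self_right, hom'] using this
  have hvn : ∀ t : ℝ, 0 ≤ t → v t ⬝ᵥ n = 0 := by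
    intro t ht
    have := congrArg (· ⬝ᵥ n) (h2 t ht)
    simp only [add_dotProduct, neg_dotProduct, cross_dot_self_right] at this
    simpa [hom'] using this
  have hv0 : v 0 = 0 := by
    have h3 := cross_cross_unit hn (v 0)
    rw [h0, hvn 0 le_rfl] at h3
    simpa using h3
  -- Since `v` is tangential it equals `-((v × n) × n)`, so its whole derivative is determined by
  -- `v' × n`. Each pair of components of `v` and `u × n` then satisfies the scalar system.
  have hwd : ∀ t : ℝ, 0 ≤ t →
      HasDerivWithinAt v ((1 / om : ℂ) • (u t ⨯₃ n)) (Set.Ici 0) t := by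
    intro t ht
    have h4 : HasDerivWithinAt (fun t => -((v t ⨯₃ n) ⨯₃ n)) (-((v' t ⨯₃ n) ⨯₃ n)) (Set.Ici 0) t :=
      (hcd _ _ t (hcd _ _ t (hv t ht))).neg
    have h5 : -((v' t ⨯₃ n) ⨯₃ n) = (1 / om : ℂ) • (u t ⨯₃ n) := by
      rw [eq_neg_of_add_eq_zero_left (h1 t ht)]
      simp
    rw [h5] at h4
    refine h4.congr (fun s hs => ?_) ?_
    · simp [cross_cross_unit hn, hvn s hs]
    · simp [cross_cross_unit hn, hvn t ht]
  have hzd : ∀ t : ℝ, 0 ≤ t →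
      HasDerivWithinAt (fun t => u t ⨯₃ n) ((Complex.I * om) • v t) (Set.Ici 0) t := by
    intro t ht
    have h3 := hcd _ _ t (hu t ht)
    rwa [← sub_eq_zero.1 ((neg_add_eq_sub _ _).symm.trans (h2 t ht))] at h3
  have hvz : ∀ t : ℝ, 0 ≤ t → v t = 0 := by
    intro t ht
    funext j
    refine eq_zero_of_squareIntegrable hom (w := fun t => v t j) (z := fun t => (u t ⨯₃ n) j)
      (fun s hs => hasDerivWithinAt_pi.1 (hwd s hs) j)
      (fun s hs => hasDerivWithinAt_pi.1 (hzd s hs) j) (by simp [hv0]) hB (fun s hs => ?_) ht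
    exact (Finset.single_le_sum (f := fun j => ‖v s j‖ ^ 2) (fun i _ => by positivity)
      (Finset.mem_univ j)).trans (hvB s hs)
  refine ⟨?_, hvz t ht⟩
  -- Once `v` vanishes, so does its one-sided derivative, which is `u × n / ω`.
  have h6 : (1 / om : ℂ) • (u t ⨯₃ n) = 0 :=
    (uniqueDiffOn_Ici (0 : ℝ) t ht).eq_deriv _ (hwd t ht)
      ((hasDerivWithinAt_const t _ (0 : C3)).congr (fun s hs => hvz s hs) (hvz t ht))
  have h7 : u t ⨯₃ n = 0 := by simpa [hom'] using h6
  have h8 := cross_cross_unit hn (u t)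
  rw [h7, hun t ht] at h8
  simpa using h8

/-! ### The recursion -/

/-- The two profiles agree on `Γ × [0, ∞)`. -/
def ProfileEq (Ω : Set E3) (u v : Profile) : Prop :=
  ∀ x ∈ frontier Ω, ∀ η : ℝ, 0 ≤ η → u x η = v x η

/-! ### Dependence on the values over `Γ × [0, ∞)` only. -/

section Congr

variable {Ω : Set E3} {om εr : ℝ} {u v u' v' : Profile}

theorem ProfileEq.dEta_eq (hu : ProfileEq Ω u u') {x : E3} (hx : x ∈ frontier Ω) {η : ℝ}
    (hη : 0 ≤ η) : dEta u x η = dEta u' x η :=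
  derivWithin_congr (s := Set.Ici 0) (fun t ht => hu x hx t ht) (hu x hx η hη)

theorem opAH_congr (hΩ : IsSmoothBoundedDomain Ω) (hu : ProfileEq Ω u u') (hv : ProfileEq Ω v v')
    (l : ℕ) : ProfileEq Ω (opAH Ω om εr l u v) (opAH Ω om εr l u' v') := by
  intro x hx η hη
  have h1 := (IsSurfaceOperator.opC hΩ).congr _ _ (fun y hy => hv y hy η hη) hx
  have h2 := (IsSurfaceOperator.opCM hΩ).congr _ _ (fun y hy => hv y hy η hη) hx
  unfold opAH lhsH
  rw [h1, h2, hv.dEta_eq hx hη, hu x hx η hη]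

theorem opAE_congr (hΩ : IsSmoothBoundedDomain Ω) (hu : ProfileEq Ω u u') (hv : ProfileEq Ω v v')
    (l : ℕ) : ProfileEq Ω (opAE Ω om l u v) (opAE Ω om l u' v') := by
  intro x hx η hη
  have h1 := (IsSurfaceOperator.opC hΩ).congr _ _ (fun y hy => hu y hy η hη) hx
  have h2 := (IsSurfaceOperator.opCM hΩ).congr _ _ (fun y hy => hu y hy η hη) hx
  unfold opAE
  rw [h1, h2, hu.dEta_eq hx hη, hv x hx η hη]

theorem dEta_zero : dEta 0 = 0 := by
  funext x η
  exact congrFun (derivWithin_const (Set.Ici (0 : ℝ)) (0 : C3)) η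

theorem opAH_zero (hΩ : IsSmoothBoundedDomain Ω) {x : E3} (hx : x ∈ frontier Ω) (l : ℕ) (η : ℝ) :
    opAH Ω om εr l 0 0 x η = 0 := by
  have h1 := (IsSurfaceOperator.opC hΩ).map_zero hx
  have h2 := (IsSurfaceOperator.opCM hΩ).map_zero hx
  unfold opAH lhsH
  simp only [dEta_zero, Pi.zero_apply, h1, h2]
  split <;> simp

theorem opAE_zero (hΩ : IsSmoothBoundedDomain Ω) {x : E3} (hx : x ∈ frontier Ω) (l : ℕ) (η : ℝ) :
    opAE Ω om l 0 0 x η = 0 := by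
  have h1 := (IsSurfaceOperator.opC hΩ).map_zero hx
  have h2 := (IsSurfaceOperator.opCM hΩ).map_zero hx
  unfold opAE
  simp only [dEta_zero, Pi.zero_apply, h1, h2]
  split <;> simp

theorem ProfileEq.lag {F F' : ℕ → Profile} {k : ℕ} (h : ∀ j < k, ProfileEq Ω (F j) (F' j)) {l : ℕ}
    (hl : 1 ≤ l) : ProfileEq Ω (lag F k l) (lag F' k l) := by
  intro x hx η hη
  unfold BoundaryLayer.lag
  split_ifs with hlk
  · exact h _ (by lia) x hx η hη
  · rfl

end Congr

/-- Recursive construction of a sequence whose terms are constrained by the previous ones. -/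
theorem exists_seq_of_recursive {α : Type*} (a₀ : α) (P : ℕ → (ℕ → α) → α → Prop)
    (hcongr : ∀ k f f' a, (∀ j < k, f j = f' j) → P k f a → P k f' a)
    (hex : ∀ k f, (∀ j < k, P j f (f j)) → ∃ a, P k f a) : ∃ f, ∀ k, P k f (f k) := by
  classical
  -- Outside the good case any value will do; `a₀` makes the choice of a next term total.
  have hch : ∀ k f, ∃ a, (∀ j < k, P j f (f j)) → P k f a := by
    intro k f
    by_cases h : ∀ j < k, P j f (f j)
    · exact (hex k f h).imp fun a ha _ => ha
    · exact ⟨a₀, fun h' => absurd h' h⟩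
  choose next hnext using hch
  -- `S m` is the sequence after `m` updates: its entries below `m` are final, so the limit is the
  -- diagonal `S (k + 1) k`.
  let S : ℕ → ℕ → α := fun m =>
    Nat.rec (fun _ => a₀) (fun k f => Function.update f k (next k f)) m
  have hS : ∀ m, S (m + 1) = Function.update (S m) m (next m (S m)) := fun _ => rfl
  have hstab : ∀ m j, j < m → S m j = S (j + 1) j := by
    intro m j hjm
    induction m with
    | zero => lia
    | succ m ih =>
      rcases Nat.lt_succ_iff_lt_or_eq.1 hjm with h | h
      · rw [hS, Function.update_of_ne h.ne, ih h]
      · rw [h]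
  refine ⟨fun k => S (k + 1) k, fun k => ?_⟩
  induction k using Nat.strong_induction_on with
  | _ k ih =>
    have h1 : ∀ j < k, P j (S k) (S k j) := by
      intro j hj
      rw [hstab k j hj]
      exact hcongr j _ _ _ (fun i hi => (hstab k i (hi.trans hj)).symm) (ih j hj)
    have h2 := hcongr k _ (fun k => S (k + 1) k) _ (fun j hj => hstab k j hj) (hnext k (S k) h1)
    simpa [hS k] using h2

/-! ### The inductive step and its consequences. -/

/-- The conditions on the profiles of index `k`, given the preceding ones. -/
structure IsExpPolyStep (Ω : Set E3) (om εr : ℝ) (He : ℕ → E3 → C3) (k : ℕ)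
    (EH : ℕ → Profile × Profile) (p : Profile × Profile) : Prop where
  expPoly_E : IsExpPoly Ω (k + 1) p.1
  expPoly_H : IsExpPoly Ω (k + 1) p.2
  expPoly_lhsH : IsExpPoly Ω k (lhsH Ω om p.1 p.2)
  expPoly_lhsE : IsExpPoly Ω k (lhsE Ω om p.1 p.2)
  eq_H : ∀ x ∈ frontier Ω, ∀ η : ℝ, 0 ≤ η → lhsH Ω om p.1 p.2 x η
    = ∑ l ∈ Finset.Icc 1 4,
        opAH Ω om εr l (lag (fun j => (EH j).1) k l) (lag (fun j => (EH j).2) k l) x η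
  eq_E : ∀ x ∈ frontier Ω, ∀ η : ℝ, 0 ≤ η → lhsE Ω om p.1 p.2 x η
    = ∑ l ∈ Finset.Icc 1 2,
        opAE Ω om l (lag (fun j => (EH j).1) k l) (lag (fun j => (EH j).2) k l) x η
  boundary : ∀ x ∈ frontier Ω, p.2 x 0 ⨯₃ nC Ω x = He k x ⨯₃ nC Ω x

theorem IsSmoothBoundedDomain.exists_isExpPolyStep {Ω : Set E3} (hΩ : IsSmoothBoundedDomain Ω)
    {om : ℝ} (hom : om ≠ 0) (εr : ℝ) {He : ℕ → E3 → C3} {k : ℕ}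
    (hHe : ContDiffOn ℝ ∞ (fun x => He k x ⨯₃ nC Ω x) (frontier Ω)) (EH : ℕ → Profile × Profile)
    (h : ∀ j < k, IsExpPolyStep Ω om εr He j EH (EH j)) :
    ∃ p, IsExpPolyStep Ω om εr He k EH p := by
  have hF : IsExpPoly Ω k fun x η => ∑ l ∈ Finset.Icc 1 4,
      opAH Ω om εr l (lag (fun j => (EH j).1) k l) (lag (fun j => (EH j).2) k l) x η := by
    refine IsExpPoly.sum _ fun l hl => ?_
    have hl1 := (Finset.mem_Icc.1 hl).1
    by_cases hlk : l ≤ k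
    -- At order `k - l` the profiles have `k - l + 1` terms and the left-hand sides only `k - l`;
    -- the operator of index `l` brings this to `k`.
    · have hs := h (k - l) (by lia)
      have := hΩ.isExpPoly_opAH om εr hs.expPoly_E hs.expPoly_H hs.expPoly_lhsH hl
      simp only [lag, hlk, if_true]
      rwa [Nat.sub_add_cancel hlk] at this
    · simp only [lag, hlk, if_false]
      exact IsExpPoly.zero.congr fun x hx η _ => opAH_zero hΩ hx l η
  have hG : IsExpPoly Ω k fun x η => ∑ l ∈ Finset.Icc 1 2,
      opAE Ω om l (lag (fun j => (EH j).1) k l) (lag (fun j => (EH j).2) k l) x η := by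
    refine IsExpPoly.sum _ fun l hl => ?_
    have hl1 := (Finset.mem_Icc.1 hl).1
    by_cases hlk : l ≤ k
    · have hs := h (k - l) (by lia)
      have := hΩ.isExpPoly_opAE om hs.expPoly_E hs.expPoly_lhsE hl
      simp only [lag, hlk, if_true]
      rwa [Nat.sub_add_cancel hlk] at this
    · simp only [lag, hlk, if_false]
      exact IsExpPoly.zero.congr fun x hx η _ => opAE_zero hΩ hx l η
  obtain ⟨E, H, hE, hH, h1, h2, h3⟩ := hΩ.exists_step hom hF hG (He k) hHe
  -- The new left-hand sides coincide with right-hand sides having `k` terms, which carries the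
  -- sharper bound on to the next orders.
  exact ⟨(E, H), hE, hH, hF.congr h1, hG.congr h2, h1, h2, h3⟩

/-- The sums start at `l = 1`, so only orders below `k` enter. -/
theorem IsExpPolyStep.congr {Ω : Set E3} {om εr : ℝ} {He : ℕ → E3 → C3} {k : ℕ}
    {EH EH' : ℕ → Profile × Profile} {p : Profile × Profile}
    (h : IsExpPolyStep Ω om εr He k EH p) (hEH : ∀ j < k, EH j = EH' j) :
    IsExpPolyStep Ω om εr He k EH' p := by
  have hlag : ∀ (π : Profile × Profile → Profile) (l : ℕ), 1 ≤ l →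
      lag (fun j => π (EH j)) k l = lag (fun j => π (EH' j)) k l := by
    intro π l hl
    unfold lag
    split_ifs with hlk
    · exact congrArg π (hEH _ (by lia))
    · rfl
  refine ⟨h.1, h.2, h.3, h.4, fun x hx η hη => ?_, fun x hx η hη => ?_, h.7⟩
  · rw [h.eq_H x hx η hη]
    refine Finset.sum_congr rfl fun l hl => ?_
    rw [hlag Prod.fst l (Finset.mem_Icc.1 hl).1, hlag Prod.snd l (Finset.mem_Icc.1 hl).1]
  · rw [h.eq_E x hx η hη]
    refine Finset.sum_congr rfl fun l hl => ?_
    rw [hlag Prod.fst l (Finset.mem_Icc.1 hl).1, hlag Prod.snd l (Finset.mem_Icc.1 hl).1]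

/-- By strong induction the right-hand sides of order `k` agree, so the difference solves the
homogeneous problem at each boundary point. -/
theorem IsProfileSolution.unique {Ω : Set E3} (hΩ : IsSmoothBoundedDomain Ω) {om εr : ℝ}
    (hom : 0 < om) {He : ℕ → E3 → C3} {E H E' H' : ℕ → Profile}
    (hs : IsProfileSolution Ω om εr He E H) (hs' : IsProfileSolution Ω om εr He E' H') (k : ℕ) :
    ProfileEq Ω (E' k) (E k) ∧ ProfileEq Ω (H' k) (H k) := by
  induction k using Nat.strong_induction_on with
  | _ k ih =>
    have hFF : ∀ x ∈ frontier Ω, ∀ η : ℝ, 0 ≤ η →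
        lhsH Ω om (E' k) (H' k) x η = lhsH Ω om (E k) (H k) x η := by
      intro x hx η hη
      rw [hs.eq_H k x hx η hη, hs'.eq_H k x hx η hη]
      refine Finset.sum_congr rfl fun l hl => ?_
      have hl1 := (Finset.mem_Icc.1 hl).1
      exact opAH_congr hΩ (ProfileEq.lag (fun j hj => (ih j hj).1) hl1)
        (ProfileEq.lag (fun j hj => (ih j hj).2) hl1) l x hx η hη
    have hGG : ∀ x ∈ frontier Ω, ∀ η : ℝ, 0 ≤ η →
        lhsE Ω om (E' k) (H' k) x η = lhsE Ω om (E k) (H k) x η := by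
      intro x hx η hη
      rw [hs.eq_E k x hx η hη, hs'.eq_E k x hx η hη]
      refine Finset.sum_congr rfl fun l hl => ?_
      have hl1 := (Finset.mem_Icc.1 hl).1
      exact opAE_congr hΩ (ProfileEq.lag (fun j hj => (ih j hj).1) hl1)
        (ProfileEq.lag (fun j hj => (ih j hj).2) hl1) l x hx η hη
    have key : ∀ x ∈ frontier Ω, ∀ η : ℝ, 0 ≤ η →
        E' k x η - E k x η = 0 ∧ H' k x η - H k x η = 0 := by
      intro x hx η hη
      refine homogeneous_unique hom (hΩ.nC_dot_self hx)
        (u := fun t => E' k x t - E k x t) (v := fun t => H' k x t - H k x t)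
        (fun t ht => ((hs'.smooth_E k).hasDerivWithinAt hx ht).sub
          ((hs.smooth_E k).hasDerivWithinAt hx ht))
        (fun t ht => ((hs'.smooth_H k).hasDerivWithinAt hx ht).sub
          ((hs.smooth_H k).hasDerivWithinAt hx ht))
        (fun t ht => ?_) (fun t ht => ?_) ?_
        -- The dominating function comes from `|a - b|² ≤ 2 |a|² + 2 |b|²`.
        (((hs'.integrable_H k x hx).const_mul 2).add ((hs.integrable_H k x hx).const_mul 2))
        (fun t ht => ?_) hη
      · have := sub_eq_zero.2 (hFF x hx t ht)
        rw [← this, lhsH, lhsH, map_sub, LinearMap.sub_apply]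
        module
      · have := sub_eq_zero.2 (hGG x hx t ht)
        rw [← this, lhsE, lhsE, map_sub, LinearMap.sub_apply]
        module
      · rw [map_sub, LinearMap.sub_apply, hs'.boundary k x hx, hs.boundary k x hx, sub_self]
      · simp only [Pi.add_apply, Finset.mul_sum, ← Finset.sum_add_distrib]
        refine Finset.sum_le_sum fun j _ => ?_
        have h1 := norm_sub_le (H' k x t j) (H k x t j)
        have h2 := norm_nonneg (H' k x t j - H k x t j)
        simp only [Pi.sub_apply]
        nlinarith [sq_nonneg (‖H' k x t j‖ - ‖H k x t j‖)]
    exact ⟨fun x hx η hη => sub_eq_zero.1 (key x hx η hη).1,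
      fun x hx η hη => sub_eq_zero.1 (key x hx η hη).2⟩

end BoundaryLayer

/-! ### Existence, form and uniqueness of the sequence. -/

theorem theorem4p2 (Ω : Set BoundaryLayer.E3) (hΩ : BoundaryLayer.IsSmoothBoundedDomain Ω)
    (om εr : ℝ) (hom : 0 < om) (hεr : 0 < εr) (He : ℕ → BoundaryLayer.E3 → BoundaryLayer.C3)
    (hHe : ∀ k, ContDiffOn ℝ ∞ (fun x => He k x ⨯₃ BoundaryLayer.nC Ω x) (frontier Ω)) :
    ∃ E H : ℕ → BoundaryLayer.Profile,
      BoundaryLayer.IsProfileSolution Ω om εr He E H ∧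
      (∀ k,
        BoundaryLayer.IsPolyProfile Ω k
          (fun x η => Complex.exp (BoundaryLayer.sqrtI * η) • E k x η) ∧
        BoundaryLayer.IsPolyProfile Ω k
          (fun x η => Complex.exp (BoundaryLayer.sqrtI * η) • H k x η)) ∧
      ∀ E' H' : ℕ → BoundaryLayer.Profile,
        BoundaryLayer.IsProfileSolution Ω om εr He E' H' →
        ∀ k, ∀ x ∈ frontier Ω, ∀ η : ℝ, 0 ≤ η → E' k x η = E k x η ∧ H' k x η = H k x η := by
  obtain ⟨EH, hEH⟩ := BoundaryLayer.exists_seq_of_recursive (0, 0)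
    (BoundaryLayer.IsExpPolyStep Ω om εr He) (fun k f f' a hf h => h.congr hf)
    (fun k f hf => hΩ.exists_isExpPolyStep hom.ne' εr (hHe k) f hf)
  have hs : BoundaryLayer.IsProfileSolution Ω om εr He (fun k => (EH k).1) (fun k => (EH k).2) :=
    { smooth_E := fun k => (hEH k).expPoly_E.isSmoothProfile
      smooth_H := fun k => (hEH k).expPoly_H.isSmoothProfile
      eq_H := fun k => (hEH k).eq_H
      eq_E := fun k => (hEH k).eq_E
      boundary := fun k => (hEH k).boundary
      integrable_H := fun k x hx => (hEH k).expPoly_H.integrableOn hx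
      integrable_E := fun k x hx => (hEH k).expPoly_E.integrableOn hx }
  refine ⟨_, _, hs, fun k => ⟨(hEH k).expPoly_E.isPolyProfile, (hEH k).expPoly_H.isPolyProfile⟩,
    fun E' H' hs' k x hx η hη => ?_⟩
  have h := hs.unique hΩ hom hs' k
  exact ⟨h.1 x hx η hη, h.2 x hx η hη⟩
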